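/- For $n\ge 1$ let $\mu_n$ be the critical ($\beta=1$, $h=0$) Curie–Weiss measure on $\{\pm1\}^n$, $$\mu_n(\sigma)=Z_n^{-1}\exp\Big(\frac1n\sum_{1\le i<j\le n}\sigma_i\sigma_j\Big),$$ where $Z_n$ is the normalizing factor. Put $S_n(\sigma)=\sigma_1+\dots+\sigma_n$ and $W_n=S_n/n^{3/4}$. Let $$p_1(t)=e^{-t^4/12},\qquad p_2(t)=\Big(\frac{t^2}{2}-\frac{t^6}{30}\Big)e^{-t^4/12},$$ $$F(x)=\frac{\int_{-\infty}^x p_1(t)\,dt}{\int_{-\infty}^\infty p_1(t)\,dt},\qquad G(x)=\frac{\int_x^\infty p_2(t)\,dt}{\int_x^\infty p_1(t)\,dt}-\frac{\int_{-\infty}^\infty p_2(t)\,dt}{\int_{-\infty}^\infty p_1(t)\,dt}.$$ Then there exist a constant $C>0$ and an integer $N\ge 1$ such that for all $n\ge N$ and all real $x$ with $0\le x\le n^{1/12}$, $$\left|\frac{\mu_n(\sigma: W_n(\sigma)>x)}{1-F(x)}-1-\frac{G(x)}{\sqrt n}\right|\le \frac{C\,(x^{12}+n^{1/3})}{n}.$$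 -/

import Mathlib

noncomputable section

namespace CurieWeiss

/-- The space `{±1}^n` of spin configurations; `ℤˣ` is the two-element set `{1, -1}`. -/
abbrev Config (n : ℕ) : Type := Fin n → ℤˣ

/-- The value `σ_i ∈ {1, -1}` of the `i`-th spin, as a real number. -/
def spin {n : ℕ} (σ : Config n) (i : Fin n) : ℝ := ((σ i : ℤ) : ℝ)

/-- The unnormalized Gibbs weight
`exp ((β / n) ∑_{i < j} σ_i σ_j + β h ∑_i σ_i)`. -/
def weight (β h : ℝ) {n : ℕ} (σ : Config n) : ℝ :=
  Real.exp (β / (n : ℝ) * ∑ i : Fin n, ∑ j ∈ Finset.Ioi i, spin σ i * spin σ j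
    + β * h * ∑ i : Fin n, spin σ i)

/-- The normalizing factor `Z_n`. -/
def partitionFunction (β h : ℝ) (n : ℕ) : ℝ := ∑ σ : Config n, weight β h σ

/-- The Gibbs probability `μ_n(σ)` of a single configuration. -/
def mass (β h : ℝ) {n : ℕ} (σ : Config n) : ℝ :=
  (partitionFunction β h n)⁻¹ * weight β h σ

/-- The Gibbs probability `μ_n(A)` of an event `A`. -/
def prob (β h : ℝ) {n : ℕ} (A : Set (Config n)) : ℝ :=
  ∑ σ : Config n, A.indicator (mass β h) σ

/-- The total spin `S_n = σ_1 + ⋯ + σ_n`. -/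
def totalSpin {n : ℕ} (σ : Config n) : ℝ := ∑ i : Fin n, spin σ i

/-- The rescaled total spin `W_n = S_n / n^{3/4}`. -/
def W {n : ℕ} (σ : Config n) : ℝ := totalSpin σ / (n : ℝ) ^ (3 / 4 : ℝ)

/-- `p₁(t) = exp (-t^4 / 12)`. -/
def p₁ (t : ℝ) : ℝ := Real.exp (-t ^ 4 / 12)

/-- `p₂(t) = (t^2 / 2 - t^6 / 30) exp (-t^4 / 12)`. -/
def p₂ (t : ℝ) : ℝ := (t ^ 2 / 2 - t ^ 6 / 30) * Real.exp (-t ^ 4 / 12)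

/-- The limiting distribution function, with density proportional to `p₁`. -/
def F (x : ℝ) : ℝ := (∫ t in Set.Iic x, p₁ t) / ∫ t, p₁ t

/-- The first-order correction. -/
def G (x : ℝ) : ℝ :=
  (∫ t in Set.Ioi x, p₂ t) / (∫ t in Set.Ioi x, p₁ t) - (∫ t, p₂ t) / ∫ t, p₁ t

end CurieWeiss

end

/-! The Gibbs weight depends on σ only through s = S_n, so the probability is a quotient of sums of
`latticeWeight n k` with s = 2k - n. Factors independent of k cancel, so Stirling's formula is not
needed: only ratios of neighbouring weights matter (`latticeWeight_succ`). The logarithm of such a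
ratio is compared with increments of explicit polynomials in s, and the comparison telescopes. At s
= t n^{3/4} the main polynomial is -t⁴/12 + (t²/2 - t⁶/30)/√n. Hence, up to a common factor c, the
weight is p₁(t) + p₂(t)/√n with error O(p₁(t)(1 + t¹²)/n) (`exists_latticeWeight_approx`).

The points t form a lattice of spacing 2n^{-3/4}, and the sums over it are Riemann sums. Every error
must be small relative to ∫_x^∞ p₁, which itself decays in x; `tailMoment_le` makes this possible,
since the k-th tail moment costs only a factor 1 + x^k. This gives the numerator
(`exists_tail_sum_approx`). By spin-flip symmetry the denominator is twice the tail at 0, plus at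
most one middle weight, which contributes O(n^{-3/4}) (`exists_normalization_approx`).

Finally (1 + u/√n)/(1 + β/√n) = 1 + (u - β)/√n + ..., where u and β are the two quotients in G(x),
so u - β = G(x) (`abs_quotient_sub_le`). -/

noncomputable section

namespace CurieWeiss

/-! ### Reduction to weights of the total spin -/

section Configurations

open Finset

/-- The spin configuration that is `1` exactly on `s`, as a bijection. -/
def configEquiv (n : ℕ) : Finset (Fin n) ≃ Config n where
  toFun s i := if i ∈ s then 1 else -1
  invFun σ := univ.filter fun i => σ i = 1
  left_inv s := by
    ext i
    by_cases h : i ∈ s <;> simp [h]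
  right_inv σ := by
    funext i
    rcases Int.units_eq_one_or (σ i) with h | h
    · simp [h]
    · simp [h]

lemma totalSpin_configEquiv {n : ℕ} (s : Finset (Fin n)) :
    totalSpin (configEquiv n s) = 2 * (#s : ℝ) - n := by
  have h : ∀ i, spin (configEquiv n s) i = 2 * (if i ∈ s then 1 else 0) - 1 := by
    intro i
    by_cases h : i ∈ s
    · simp [spin, configEquiv, h]; norm_num
    · simp [spin, configEquiv, h]
  simp only [totalSpin, h, sum_sub_distrib, ← mul_sum]
  simp

lemma sum_config_totalSpin (n : ℕ) (g : ℝ → ℝ) :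
    ∑ σ : Config n, g (totalSpin σ)
      = ∑ k ∈ range (n + 1), (n.choose k : ℝ) * g (2 * k - n) := by
  rw [← (configEquiv n).sum_comp]
  simp only [totalSpin_configEquiv]
  have := Finset.sum_powerset_apply_card (fun k => g (2 * (k : ℝ) - n))
    (x := (univ : Finset (Fin n)))
  simpa using this

lemma spin_mul_self {n : ℕ} (σ : Config n) (i : Fin n) : spin σ i * spin σ i = 1 := by
  rcases Int.units_eq_one_or (σ i) with h | h <;> simp [spin, h]

lemma totalSpin_sq {n : ℕ} (σ : Config n) :
    totalSpin σ ^ 2 = n + 2 * ∑ i : Fin n, ∑ j ∈ Ioi i, spin σ i * spin σ j := by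
  have h1 : ∑ i : Fin n, ∑ j ∈ Iio i, spin σ i * spin σ j
      = ∑ i : Fin n, ∑ j ∈ Ioi i, spin σ i * spin σ j := by
    rw [sum_comm' (t' := univ) (s' := fun j => Ioi j) (by simp)]
    simp only [mul_comm]
  have h2 : ∀ i : Fin n, ∑ j, spin σ i * spin σ j = ∑ j ∈ Iio i, spin σ i * spin σ j
      + 1 + ∑ j ∈ Ioi i, spin σ i * spin σ j := by
    intro i
    have hu : (univ : Finset (Fin n)) = (Iio i ∪ {i}) ∪ Ioi i := by
      ext j
      simp only [mem_univ, mem_union, mem_Iio, mem_singleton, mem_Ioi, true_iff]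
      rcases lt_trichotomy j i with h | h | h <;> tauto
    rw [hu, sum_union, sum_union, sum_singleton, spin_mul_self]
    · simp
    · rw [disjoint_left]
      intro j
      simp only [mem_union, mem_Iio, mem_singleton, mem_Ioi]
      rintro (h | h)
      · exact h.not_gt
      · exact h.le.not_gt
  rw [sq, totalSpin, sum_mul_sum]
  simp only [h2, sum_add_distrib, h1]
  simp
  ring

/-- The total unnormalized weight, up to the factor `exp (-1/2)`, of the configurations with
`k` spins equal to `1`. -/
def latticeWeight (n k : ℕ) : ℝ :=
  (n.choose k : ℝ) * Real.exp ((2 * (k : ℝ) - n) ^ 2 / (2 * n))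

/-- The diagonal of S_n² contributes n, hence the constant factor exp (-1/2). -/
lemma weight_eq {n : ℕ} (hn : 0 < n) (σ : Config n) :
    weight 1 0 σ = Real.exp (-(1 / 2)) * Real.exp (totalSpin σ ^ 2 / (2 * n)) := by
  rw [weight, ← Real.exp_add, totalSpin_sq]
  congr 1
  field_simp
  ring

lemma prob_eq {n : ℕ} (hn : 0 < n) (x : ℝ) :
    prob 1 0 {σ : Config n | x < W σ}
      = (∑ k ∈ range (n + 1) with x * (n : ℝ) ^ (3 / 4 : ℝ) < 2 * ((k : ℕ) : ℝ) - n,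
          latticeWeight n k)
        / ∑ k ∈ range (n + 1), latticeWeight n k := by
  have hpos : (0 : ℝ) < (n : ℝ) ^ (3 / 4 : ℝ) := by positivity
  have hZ : partitionFunction 1 0 n
      = Real.exp (-(1 / 2)) * ∑ k ∈ range (n + 1), latticeWeight n k := by
    simp only [partitionFunction, weight_eq hn, ← mul_sum]
    rw [sum_config_totalSpin n fun s => Real.exp (s ^ 2 / (2 * n))]
    rfl
  have hN : prob 1 0 {σ : Config n | x < W σ} = (partitionFunction 1 0 n)⁻¹ *
      (Real.exp (-(1 / 2)) * ∑ σ : Config n,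
        if x * (n : ℝ) ^ (3 / 4 : ℝ) < totalSpin σ then
          Real.exp (totalSpin σ ^ 2 / (2 * n)) else 0) := by
    simp only [prob, mul_sum]
    refine sum_congr rfl fun σ _ => ?_
    simp only [Set.indicator_apply, Set.mem_ofPred_eq, W, lt_div_iff₀ hpos, mass, weight_eq hn]
    split_ifs <;> simp
  rw [hN, hZ, sum_config_totalSpin n fun s => if x * (n : ℝ) ^ (3 / 4 : ℝ) < s then
    Real.exp (s ^ 2 / (2 * n)) else 0, sum_filter]
  have : (∑ k ∈ range (n + 1), (n.choose k : ℝ) *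
      if x * (n : ℝ) ^ (3 / 4 : ℝ) < 2 * (k : ℝ) - n then
        Real.exp ((2 * (k : ℝ) - n) ^ 2 / (2 * n)) else 0)
      = ∑ k ∈ range (n + 1),
        if x * (n : ℝ) ^ (3 / 4 : ℝ) < 2 * (k : ℝ) - n then latticeWeight n k else 0 := by
    refine sum_congr rfl fun k _ => ?_
    split_ifs <;> simp [latticeWeight]
  rw [this, mul_inv, div_eq_mul_inv]
  have := (Real.exp_pos (-(1 / 2))).ne'
  field_simp

lemma latticeWeight_nonneg (n k : ℕ) : 0 ≤ latticeWeight n k := by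
  unfold latticeWeight; positivity

lemma latticeWeight_pos {n k : ℕ} (h : k ≤ n) : 0 < latticeWeight n k := by
  have := Nat.choose_pos h
  unfold latticeWeight; positivity

lemma latticeWeight_of_lt {n k : ℕ} (h : n < k) : latticeWeight n k = 0 := by
  simp [latticeWeight, Nat.choose_eq_zero_of_lt h]

lemma latticeWeight_symm {n k : ℕ} (h : k ≤ n) : latticeWeight n (n - k) = latticeWeight n k := by
  rw [latticeWeight, latticeWeight, Nat.choose_symm h, Nat.cast_sub h]
  congr 3
  ring

/-- The flip k ↦ n - k exchanges the two halves and fixes only n = 2k, so the normalization reduces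
to the tail at x = 0. -/
lemma sum_latticeWeight (n : ℕ) :
    ∑ k ∈ range (n + 1), latticeWeight n k
      = 2 * (∑ k ∈ range (n + 1) with n < 2 * k, latticeWeight n k)
        + ∑ k ∈ range (n + 1) with n = 2 * k, latticeWeight n k := by
  have h1 : ∑ k ∈ range (n + 1) with n < 2 * k, latticeWeight n k
      = ∑ k ∈ range (n + 1) with 2 * k < n, latticeWeight n k := by
    refine sum_bij' (fun k _ => n - k) (fun k _ => n - k) ?_ ?_ ?_ ?_ ?_ <;>
      simp only [mem_filter, mem_range]
    · intro k; omega
    · intro k; omega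
    · intro k; omega
    · intro k; omega
    · intro k hk
      exact (latticeWeight_symm (by omega)).symm
  rw [two_mul]
  nth_rewrite 2 [h1]
  simp only [sum_filter, ← sum_add_distrib]
  refine sum_congr rfl fun k _ => ?_
  rcases lt_trichotomy n (2 * k) with h | h | h
  · simp [h, h.not_gt, h.ne]
  · simp [← h]
  · simp [h, h.not_gt, h.ne']

/-- For odd n the sum is empty; for even n its only index n/2 equals (n + 1) / 2. -/
lemma sum_latticeWeight_middle (n : ℕ) :
    ∑ k ∈ range (n + 1) with n = 2 * k, latticeWeight n k ≤ latticeWeight n ((n + 1) / 2) := by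
  calc ∑ k ∈ range (n + 1) with n = 2 * k, latticeWeight n k
      ≤ ∑ k ∈ {(n + 1) / 2}, latticeWeight n k := by
        refine sum_le_sum_of_subset_of_nonneg ?_ fun k _ _ => latticeWeight_nonneg n k
        intro k
        simp only [mem_filter, mem_range, mem_singleton]
        omega
    _ = _ := sum_singleton ..

/-- Weights vanish beyond n, so a tail can be read as a sum of arbitrarily many terms, which lets M
tend to infinity later. -/
lemma sum_filter_latticeWeight_eq (n : ℕ) {P : ℕ → Prop} [DecidablePred P] {K M : ℕ}
    (hP : ∀ k, P k ↔ K ≤ k) (hM : n + 1 ≤ M) :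
    ∑ k ∈ range (n + 1) with P k, latticeWeight n k
      = ∑ i ∈ range M, latticeWeight n (K + i) := by
  have h2 : ∑ i ∈ range M, latticeWeight n (K + i) = ∑ k ∈ Ico K (K + M), latticeWeight n k := by
    rw [sum_Ico_eq_sum_range, Nat.add_sub_cancel_left]
  rw [h2]
  refine sum_subset_zero_on_sdiff ?_ ?_ fun _ _ => rfl
  · intro k
    simp only [mem_filter, mem_range, mem_Ico, hP]
    omega
  · intro k
    simp only [mem_sdiff, mem_filter, mem_range, mem_Ico, hP]
    intro h
    exact latticeWeight_of_lt (by omega)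

end Configurations

/-! ### Ratios of consecutive weights and telescoping -/

lemma log_sub_log_lower {u : ℝ} (h0 : 0 ≤ u) (h1 : u < 1) :
    2 * u + 2 / 3 * u ^ 3 + 2 / 5 * u ^ 5 ≤ Real.log (1 + u) - Real.log (1 - u) := by
  have h := Real.hasSum_log_sub_log_of_abs_lt_one (abs_lt.2 ⟨by linarith, h1⟩)
  refine le_trans (le_of_eq ?_) (h.summable.sum_le_tsum (Finset.range 3) ?_ |>.trans_eq h.tsum_eq)
  · norm_num [Finset.sum_range_succ]
  · intro i _; positivity

lemma log_sub_log_upper {u : ℝ} (h0 : 0 ≤ u) (h1 : u ≤ 1 / 2) :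
    Real.log (1 + u) - Real.log (1 - u) ≤ 2 * u + 2 / 3 * u ^ 3 + 2 / 5 * u ^ 5 + u ^ 7 := by
  have h := Real.hasSum_log_sub_log_of_abs_lt_one (abs_lt.2 ⟨by linarith, by linarith⟩)
  rw [← hasSum_nat_add_iff' 3] at h
  have hg : HasSum (fun i : ℕ => 1 / 2 * u ^ 7 * (1 / 2 : ℝ) ^ i) (1 / 2 * u ^ 7 * 2) :=
    hasSum_geometric_two.mul_left _
  have := hasSum_le (fun i => ?_) h hg
  · simp [Finset.sum_range_succ] at this
    linarith
  · have e : u ^ (2 * (i + 3) + 1) = u ^ 7 * (u ^ 2) ^ i := by ring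
    have h2 : (u ^ 2) ^ i ≤ (1 / 2 : ℝ) ^ i :=
      pow_le_pow_left₀ (by positivity) (by nlinarith) i
    have h3 : 2 * (1 / (2 * ((i + 3 : ℕ) : ℝ) + 1)) ≤ 1 / 2 := by
      push_cast
      rw [mul_one_div, div_le_div_iff₀ (by positivity) (by norm_num)]
      have : (0 : ℝ) ≤ i := i.cast_nonneg
      linarith
    rw [e]
    calc _ = 2 * (1 / (2 * ((i + 3 : ℕ) : ℝ) + 1)) * (u ^ 7 * (u ^ 2) ^ i) := by ring
      _ ≤ 1 / 2 * (u ^ 7 * (1 / 2) ^ i) := by gcongr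
      _ = _ := by ring

/-- The logarithm of the ratio of consecutive lattice weights, centred at `v`. -/
def logRatio (n v : ℝ) : ℝ :=
  2 * v / n - (Real.log (1 + v / (n + 1)) - Real.log (1 - v / (n + 1)))

/-- With v = 2k + 1 - n, the midpoint of two consecutive values of s, and u = v/(n + 1), the
binomial ratio (n - k)/(k + 1) is (1 - u)/(1 + u). -/
lemma latticeWeight_succ {n k : ℕ} (hk : k < n) (hk' : n ≤ 2 * k + 1) :
    latticeWeight n (k + 1) = latticeWeight n k * Real.exp (logRatio n (2 * k + 1 - n)) := by
  have hn : (0 : ℝ) < n := by exact_mod_cast (by omega : 0 < n)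
  have hkn : (k : ℝ) + 1 ≤ n := by exact_mod_cast hk
  have hkn' : (n : ℝ) ≤ 2 * k + 1 := by exact_mod_cast hk'
  have hc : (n.choose (k + 1) : ℝ) * (k + 1) = n.choose k * (n - k) := by
    have := Nat.choose_succ_right_eq n k
    rw [← Nat.cast_sub hk.le]
    exact_mod_cast this
  have e1 : 1 + (2 * (k : ℝ) + 1 - n) / (n + 1) = 2 * (k + 1) / (n + 1) := by
    field_simp; ring
  have e2 : 1 - (2 * (k : ℝ) + 1 - n) / (n + 1) = 2 * (n - k) / (n + 1) := by
    field_simp; ring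
  have p1 : 0 < 2 * ((k : ℝ) + 1) / (n + 1) := by positivity
  have p2 : 0 < 2 * ((n : ℝ) - k) / (n + 1) := by
    have : 0 < (n : ℝ) - k := by linarith
    positivity
  have e3 : Real.exp ((2 * ((k + 1 : ℕ) : ℝ) - n) ^ 2 / (2 * n))
      = Real.exp ((2 * (k : ℝ) - n) ^ 2 / (2 * n)) * Real.exp (2 * (2 * k + 1 - n) / n) := by
    rw [← Real.exp_add]
    congr 1
    push_cast
    field_simp
    ring
  have e4 : (n.choose (k + 1) : ℝ) = n.choose k * (n - k) / (k + 1) := by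
    rw [← hc]; field_simp
  rw [logRatio, Real.exp_sub, Real.exp_sub, e1, e2, Real.exp_log p1, Real.exp_log p2,
    latticeWeight, latticeWeight, e3, e4]
  field_simp

/-- A one-sided bound reaching all the way to v = n, because it needs only the lower bound for the
logarithm. The generous term 2s²/n² stays at most 2 for 0 ≤ s ≤ n, so it costs only a bounded
factor. -/
lemma logRatio_le {n v : ℝ} (hn : 1 ≤ n) (h0 : 0 ≤ v) (h1 : v ≤ n) :
    logRatio n v ≤ (2 * (v + 1) ^ 2 / n ^ 2 - (v + 1) ^ 4 / (12 * n ^ 3))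
      - (2 * (v - 1) ^ 2 / n ^ 2 - (v - 1) ^ 4 / (12 * n ^ 3)) := by
  have hu1 : v / (n + 1) < 1 := by rw [div_lt_one (by linarith)]; linarith
  have h := log_sub_log_lower (u := v / (n + 1)) (by positivity) hu1
  -- In terms of y = 1/n and z = 1/(n + 1), the identity y - z = yz makes the replacement of n + 1
  -- by n polynomial.
  obtain ⟨y, hy⟩ : ∃ y, y = 1 / n := ⟨_, rfl⟩
  obtain ⟨z, hz⟩ : ∃ z, z = 1 / (n + 1) := ⟨_, rfl⟩
  have hy0 : 0 < y := by rw [hy]; positivity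
  have hz0 : 0 < z := by rw [hz]; positivity
  have hyz : y - z = y * z := by rw [hy, hz]; field_simp; ring
  have hzy : z ≤ y := by nlinarith
  have hy1 : y ≤ 1 := by rw [hy, div_le_one (by linarith)]; exact hn
  have hvy : v * y ≤ 1 := by rw [hy, mul_one_div, div_le_one (by linarith)]; exact h1
  have c1 : y * z ≤ y ^ 2 := by nlinarith
  have c2 : y ^ 3 - z ^ 3 ≤ 3 * y ^ 4 := by
    calc y ^ 3 - z ^ 3 = (y - z) * (y ^ 2 + y * z + z ^ 2) := by ring
      _ = (y * z) * (y ^ 2 + y * z + z ^ 2) := by rw [hyz]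
      _ ≤ y ^ 2 * (y ^ 2 + y * y + y ^ 2) := by gcongr
      _ = _ := by ring
  have c3 : v ^ 3 * (y ^ 3 - z ^ 3) ≤ 3 * (v * y ^ 2) := by
    calc v ^ 3 * (y ^ 3 - z ^ 3) ≤ v ^ 3 * (3 * y ^ 4) := by gcongr
      _ = 3 * (v * y ^ 2) * (v * y) ^ 2 := by ring
      _ ≤ 3 * (v * y ^ 2) * 1 ^ 2 := by gcongr
      _ = _ := by ring
  have c4 : v * (y * z) ≤ v * y ^ 2 := by gcongr
  have c5 : v * y ^ 3 ≤ v * y ^ 2 := by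
    gcongr v * ?_
    exact pow_le_pow_of_le_one hy0.le hy1 (by norm_num)
  have e1 : v / (n + 1) = v * z := by rw [hz]; ring
  have hv : 0 ≤ v * y ^ 2 := by positivity
  have c6 : 0 ≤ (v * z) ^ 5 := by positivity
  rw [e1] at h
  calc logRatio n v ≤ 2 * (v * y) - (2 * (v * z) + 2 / 3 * (v * z) ^ 3) := by
        rw [logRatio, e1, hy]
        linarith [show 2 * v / n = 2 * (v * (1 / n)) by ring]
    _ = 2 * (v * (y - z)) + 2 / 3 * (v ^ 3 * (y ^ 3 - z ^ 3)) - 2 / 3 * v ^ 3 * y ^ 3 := by ring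
    _ ≤ 8 * (v * y ^ 2) - 2 / 3 * (v ^ 3 * y ^ 3 + v * y ^ 3) := by
        rw [hyz]; linarith
    _ = _ := by rw [hy]; field_simp; ring

lemma latticeWeight_le {n : ℕ} (hn : 1 ≤ n) {k₀ k : ℕ} (h0 : n ≤ 2 * k₀) (hk : k₀ ≤ k) :
    latticeWeight n k ≤ latticeWeight n k₀ *
      Real.exp ((2 * (2 * (k : ℝ) - n) ^ 2 / n ^ 2 - (2 * (k : ℝ) - n) ^ 4 / (12 * n ^ 3))
      - (2 * (2 * (k₀ : ℝ) - n) ^ 2 / n ^ 2 - (2 * (k₀ : ℝ) - n) ^ 4 / (12 * n ^ 3))) := by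
  induction k, hk using Nat.le_induction with
  | base => simp
  | succ k hk ih =>
    rcases lt_or_ge k n with hkn | hkn
    · have hkn' : (k : ℝ) + 1 ≤ n := by exact_mod_cast hkn
      have hk' : (n : ℝ) ≤ 2 * k := by exact_mod_cast (by omega : n ≤ 2 * k)
      have h := logRatio_le (n := n) (v := 2 * k + 1 - n) (by exact_mod_cast hn)
        (by linarith) (by linarith)
      rw [latticeWeight_succ hkn (by omega)]
      calc _ ≤ _ * Real.exp _ := mul_le_mul ih (Real.exp_le_exp.2 h) (Real.exp_pos _).le
            (mul_nonneg (latticeWeight_nonneg _ _) (Real.exp_pos _).le)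
        _ = _ := by
          rw [mul_assoc, ← Real.exp_add]
          congr 2
          push_cast
          ring
    · rw [latticeWeight_of_lt (by omega)]
      exact mul_nonneg (latticeWeight_nonneg _ _) (Real.exp_pos _).le

/-- The leading terms of the logarithm of the lattice weight. -/
def phase (n s : ℝ) : ℝ := s ^ 2 / (2 * n ^ 2) - s ^ 4 / (12 * n ^ 3) - s ^ 6 / (30 * n ^ 5)

/-- The error bound for `phase`. -/
def phaseError (n s : ℝ) : ℝ := s ^ 2 / n ^ 3 + s ^ 4 / n ^ 4 + s ^ 8 / n ^ 7

/-- The increments of `phase` match the series through u⁵. The increments of `phaseError` absorb the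
u⁷ remainder, the change from n + 1 to n, and the lower-order terms of the differences. Both sides
are differences at v ± 1, so the bound telescopes. -/
lemma abs_logRatio_sub_le {n v : ℝ} (hn : 1 ≤ n) (h0 : 0 ≤ v) (h1 : v ≤ n / 2) :
    |logRatio n v - (phase n (v + 1) - phase n (v - 1))|
      ≤ phaseError n (v + 1) - phaseError n (v - 1) := by
  have hu1 : v / (n + 1) ≤ 1 / 2 := by rw [div_le_iff₀ (by linarith)]; linarith
  have hl := log_sub_log_lower (u := v / (n + 1)) (by positivity) (by linarith)
  have hu := log_sub_log_upper (u := v / (n + 1)) (by positivity) hu1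
  obtain ⟨y, hy⟩ : ∃ y, y = 1 / n := ⟨_, rfl⟩
  obtain ⟨z, hz⟩ : ∃ z, z = 1 / (n + 1) := ⟨_, rfl⟩
  have hy0 : 0 < y := by rw [hy]; positivity
  have hz0 : 0 < z := by rw [hz]; positivity
  have hyz : y - z = y * z := by rw [hy, hz]; field_simp; ring
  have hzy : z ≤ y := by nlinarith
  have hy1 : y ≤ 1 := by rw [hy, div_le_one (by linarith)]; exact hn
  have hvy : v * y ≤ 1 := by rw [hy, mul_one_div, div_le_one (by linarith)]; linarith
  have e1 : v / (n + 1) = v * z := by rw [hz]; ring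
  rw [e1] at hl hu
  have c1 : y * z ≤ y ^ 2 := by nlinarith
  have c2 : y ^ 3 - z ^ 3 ≤ 3 * y ^ 4 := by
    calc y ^ 3 - z ^ 3 = (y - z) * (y ^ 2 + y * z + z ^ 2) := by ring
      _ = (y * z) * (y ^ 2 + y * z + z ^ 2) := by rw [hyz]
      _ ≤ y ^ 2 * (y ^ 2 + y * y + y ^ 2) := by gcongr
      _ = _ := by ring
  have c5 : y ^ 5 - z ^ 5 ≤ 5 * y ^ 6 := by
    calc y ^ 5 - z ^ 5
        = (y - z) * (y ^ 4 + y ^ 3 * z + y ^ 2 * z ^ 2 + y * z ^ 3 + z ^ 4) := by ring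
      _ = (y * z) * (y ^ 4 + y ^ 3 * z + y ^ 2 * z ^ 2 + y * z ^ 3 + z ^ 4) := by rw [hyz]
      _ ≤ y ^ 2 * (y ^ 4 + y ^ 3 * y + y ^ 2 * y ^ 2 + y * y ^ 3 + y ^ 4) := by gcongr
      _ = _ := by ring
  have d2 : 0 ≤ v * (y * y * z) := by positivity
  have d2' : v * (y * y * z) ≤ v * y ^ 3 := by
    calc v * (y * y * z) ≤ v * (y * y * y) := by gcongr
      _ = _ := by ring
  have d3 : 0 ≤ v ^ 3 * (y ^ 3 - z ^ 3) :=
    mul_nonneg (by positivity) (sub_nonneg.2 (by gcongr))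
  have d3' : v ^ 3 * (y ^ 3 - z ^ 3) ≤ 3 * (v ^ 3 * y ^ 4) := by
    calc v ^ 3 * (y ^ 3 - z ^ 3) ≤ v ^ 3 * (3 * y ^ 4) := by gcongr
      _ = _ := by ring
  have d5 : 0 ≤ v ^ 5 * (y ^ 5 - z ^ 5) :=
    mul_nonneg (by positivity) (sub_nonneg.2 (by gcongr))
  have d5' : v ^ 5 * (y ^ 5 - z ^ 5) ≤ 5 * (v ^ 3 * y ^ 4) := by
    calc v ^ 5 * (y ^ 5 - z ^ 5) ≤ v ^ 5 * (5 * y ^ 6) := by gcongr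
      _ = 5 * (v ^ 3 * y ^ 4) * (v * y) ^ 2 := by ring
      _ ≤ 5 * (v ^ 3 * y ^ 4) * 1 ^ 2 := by gcongr
      _ = _ := by ring
  have d7 : (v * z) ^ 7 ≤ v ^ 7 * y ^ 7 := by rw [← mul_pow]; gcongr
  have f5 : v * y ^ 5 ≤ v * y ^ 3 := by
    gcongr v * ?_
    exact pow_le_pow_of_le_one hy0.le hy1 (by norm_num)
  have f35 : v ^ 3 * y ^ 5 ≤ v ^ 3 * y ^ 4 := by
    gcongr v ^ 3 * ?_
    exact pow_le_pow_of_le_one hy0.le hy1 (by norm_num)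
  have g0 : 0 ≤ v * y ^ 3 := by positivity
  have g1 : 0 ≤ v ^ 3 * y ^ 4 := by positivity
  have g2 : 0 ≤ v * y ^ 4 := by positivity
  have g3 : 0 ≤ v ^ 7 * y ^ 7 := by positivity
  have g4 : 0 ≤ v ^ 5 * y ^ 7 := by positivity
  have g5 : 0 ≤ v ^ 3 * y ^ 7 := by positivity
  have g6 : 0 ≤ v * y ^ 7 := by positivity
  have g7 : 0 ≤ v * y ^ 5 := by positivity
  have g8 : 0 ≤ v ^ 3 * y ^ 5 := by positivity
  have hE : phaseError n (v + 1) - phaseError n (v - 1)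
      = 4 * (v * y ^ 3) + 8 * (v ^ 3 * y ^ 4) + 8 * (v * y ^ 4)
        + 16 * (v ^ 7 * y ^ 7) + 112 * (v ^ 5 * y ^ 7) + 112 * (v ^ 3 * y ^ 7)
        + 16 * (v * y ^ 7) := by
    rw [phaseError, phaseError, hy]; field_simp; ring
  have hP : phase n (v + 1) - phase n (v - 1)
      = 2 * (v * (y - z)) + 2 * (v * z) - 2 * (v * y) + 2 * (v * y ^ 2)
        - 2 / 3 * (v ^ 3 * y ^ 3) - 2 / 3 * (v * y ^ 3)
        - 2 / 5 * (v ^ 5 * y ^ 5) - 4 / 3 * (v ^ 3 * y ^ 5) - 2 / 5 * (v * y ^ 5) := by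
    rw [phase, phase, hy]; field_simp; ring
  have hyy : v * y ^ 2 = v * (y - z) + v * (y * y * z) := by
    have : y ^ 2 = y * z + y * (y - z) := by ring
    rw [hyz] at this ⊢
    rw [this]; ring
  have hR : logRatio n v
      = 2 * (v * y) - (Real.log (1 + v * z) - Real.log (1 - v * z)) := by
    rw [logRatio, e1, hy]; ring
  rw [hE, hP, hR, abs_le]
  have x3 : (v * z) ^ 3 = v ^ 3 * y ^ 3 - v ^ 3 * (y ^ 3 - z ^ 3) := by ring
  have x5 : (v * z) ^ 5 = v ^ 5 * y ^ 5 - v ^ 5 * (y ^ 5 - z ^ 5) := by ring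
  rw [x3, x5] at hl hu
  have x1 : v * (y - z) = v * y - v * z := by ring
  constructor <;> linarith

lemma latticeWeight_bounds {n : ℕ} (hn : 1 ≤ n) {k₀ k : ℕ} (h0 : n ≤ 2 * k₀) (hk : k₀ ≤ k)
    (hkn : 2 * (k : ℝ) - n ≤ n / 2) :
    latticeWeight n k₀ * Real.exp (phase n (2 * k - n) - phase n (2 * k₀ - n)
        - (phaseError n (2 * k - n) - phaseError n (2 * k₀ - n))) ≤ latticeWeight n k ∧
      latticeWeight n k ≤ latticeWeight n k₀ * Real.exp (phase n (2 * k - n) - phase n (2 * k₀ - n)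
        + (phaseError n (2 * k - n) - phaseError n (2 * k₀ - n))) := by
  have hn' : (1 : ℝ) ≤ n := by exact_mod_cast hn
  induction k, hk using Nat.le_induction with
  | base => simp
  | succ k hk ih =>
    push_cast at hkn
    have hlt : k < n := by
      have : (k : ℝ) < n := by linarith
      exact_mod_cast this
    have hk' : (n : ℝ) ≤ 2 * k := by exact_mod_cast (by omega : n ≤ 2 * k)
    obtain ⟨ih1, ih2⟩ := ih (by linarith)
    have h := abs_le.1 <| abs_logRatio_sub_le (n := n) (v := 2 * k + 1 - n) hn'
      (by linarith) (by linarith)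
    have ea : 2 * (k : ℝ) + 1 - n + 1 = 2 * ((k + 1 : ℕ) : ℝ) - n := by push_cast; ring
    have eb : 2 * (k : ℝ) + 1 - n - 1 = 2 * (k : ℝ) - n := by ring
    rw [ea, eb] at h
    rw [latticeWeight_succ hlt (by omega)]
    generalize logRatio n (2 * k + 1 - n) = l at h ⊢
    generalize phase n (2 * ((k + 1 : ℕ) : ℝ) - n) = a₁ at h ⊢
    generalize phaseError n (2 * ((k + 1 : ℕ) : ℝ) - n) = b₁ at h ⊢
    generalize phase n (2 * k - n) = a at h ih1 ih2
    generalize phaseError n (2 * k - n) = b at h ih1 ih2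
    generalize phase n (2 * k₀ - n) = a₀ at h ih1 ih2 ⊢
    generalize phaseError n (2 * k₀ - n) = b₀ at h ih1 ih2 ⊢
    constructor
    · calc latticeWeight n k₀ * Real.exp (a₁ - a₀ - (b₁ - b₀))
          ≤ latticeWeight n k₀ * Real.exp (a - a₀ - (b - b₀) + l) := by
            gcongr
            · exact latticeWeight_nonneg _ _
            · linarith [h.1]
        _ = latticeWeight n k₀ * Real.exp (a - a₀ - (b - b₀)) * Real.exp l := by
            rw [Real.exp_add]; ring
        _ ≤ _ := by gcongr
    · calc latticeWeight n k * Real.exp l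
          ≤ latticeWeight n k₀ * Real.exp (a - a₀ + (b - b₀)) * Real.exp l := by gcongr
        _ = latticeWeight n k₀ * Real.exp (a - a₀ + (b - b₀) + l) := by
            rw [Real.exp_add _ l]; ring
        _ ≤ _ := mul_le_mul_of_nonneg_left (Real.exp_le_exp.2 (by linarith [h.2]))
            (latticeWeight_nonneg _ _)

/-! ### Local expansion of the weights -/

lemma abs_exp_sub_one_sub_le (x : ℝ) : |Real.exp x - 1 - x| ≤ x ^ 2 * Real.exp |x| := by
  have h := Complex.norm_exp_sub_sum_le_norm_mul_exp (x : ℂ) 2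
  have e : Complex.exp x - ∑ m ∈ Finset.range 2, (x : ℂ) ^ m / (m.factorial : ℂ)
      = ((Real.exp x - 1 - x : ℝ) : ℂ) := by
    simp [Finset.sum_range_succ]
    ring
  rw [e, Complex.norm_real, Complex.norm_real] at h
  simpa using h

lemma sq_correction_le (t : ℝ) : (t ^ 2 / 2 - t ^ 6 / 30) ^ 2 ≤ 1 + t ^ 12 := by
  nlinarith [sq_nonneg (t ^ 2 / 2 + t ^ 6 / 30), sq_nonneg (t ^ 4 - 1), sq_nonneg (t ^ 2),
    sq_nonneg (t ^ 6 - t ^ 2), sq_nonneg (t ^ 6 - 1), sq_nonneg (t ^ 6)]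

lemma pow_le_one_add_pow {t : ℝ} (ht : 0 ≤ t) {i j : ℕ} (h : i ≤ j) : t ^ i ≤ 1 + t ^ j := by
  rcases le_total t 1 with h1 | h1
  · linarith [pow_le_one₀ (n := i) ht h1, pow_nonneg ht j]
  · linarith [pow_le_pow_right₀ h1 h]

lemma p₁_pos (t : ℝ) : 0 < p₁ t := Real.exp_pos _

lemma p₁_add_p₂_div (t a : ℝ) :
    p₁ t + p₂ t / a = p₁ t * (1 + (t ^ 2 / 2 - t ^ 6 / 30) / a) := by
  rw [p₁, p₂]; ring

/-- Put m = (1 + t¹²)/b⁴, let y be the correction and e the error in the exponent. Here m ≤ 2, y² ≤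
m and e ≤ 3m, so |y + e| ≤ 2 + 6 = 8 and (y + e)² ≤ 2m + 18m² ≤ 38m; these give the constants 8 and
38. -/
lemma local_approx_of_small {b t w : ℝ} (hb : 1 ≤ b) (ht : 0 ≤ t) (htb : t ^ 12 ≤ b ^ 4)
    (hl : p₁ t * Real.exp ((t ^ 2 / 2 - t ^ 6 / 30) / b ^ 2
      - (t ^ 2 / b ^ 6 + t ^ 4 / b ^ 4 + t ^ 8 / b ^ 4)) ≤ w)
    (hu : w ≤ p₁ t * Real.exp ((t ^ 2 / 2 - t ^ 6 / 30) / b ^ 2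
      + (t ^ 2 / b ^ 6 + t ^ 4 / b ^ 4 + t ^ 8 / b ^ 4))) :
    |w - (p₁ t + p₂ t / b ^ 2)| ≤ (3 + 38 * Real.exp 8) * (p₁ t * ((1 + t ^ 12) / b ^ 4)) := by
  rw [p₁_add_p₂_div]
  have hb4 : 0 < b ^ 4 := by positivity
  obtain ⟨y, hy⟩ : ∃ y, y = (t ^ 2 / 2 - t ^ 6 / 30) / b ^ 2 := ⟨_, rfl⟩
  obtain ⟨e, he⟩ : ∃ e, e = t ^ 2 / b ^ 6 + t ^ 4 / b ^ 4 + t ^ 8 / b ^ 4 := ⟨_, rfl⟩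
  obtain ⟨m, hm⟩ : ∃ m, m = (1 + t ^ 12) / b ^ 4 := ⟨_, rfl⟩
  rw [← hy, ← he] at hl hu
  rw [← hy, ← hm]
  have hm2 : m ≤ 2 := by
    rw [hm, div_le_iff₀ hb4]
    linarith [one_le_pow₀ hb (n := 4)]
  have hym : y ^ 2 ≤ m := by
    rw [hy, hm, div_pow, ← pow_mul]
    gcongr
    exact sq_correction_le t
  have hem : e ≤ 3 * m := by
    have h1 : t ^ 2 / b ^ 6 ≤ m := by
      rw [hm]
      gcongr
      · exact pow_le_one_add_pow ht (by norm_num)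
      · norm_num
    have h2 : t ^ 4 / b ^ 4 ≤ m := by
      rw [hm]
      gcongr
      exact pow_le_one_add_pow ht (by norm_num)
    have h3 : t ^ 8 / b ^ 4 ≤ m := by
      rw [hm]
      gcongr
      exact pow_le_one_add_pow ht (by norm_num)
    linarith
  have he0 : 0 ≤ e := by rw [he]; positivity
  have hm0 : 0 ≤ m := by rw [hm]; positivity
  have hy2 : |y| ≤ 2 := abs_le_of_sq_le_sq (by linarith : y ^ 2 ≤ 2 ^ 2) (by norm_num)
  have hz8 : |y + e| ≤ 8 := (abs_add_le y e).trans (by rw [abs_of_nonneg he0]; linarith)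
  have hz : (y + e) ^ 2 ≤ 38 * m := by nlinarith [sq_nonneg (y - e)]
  have hexp : Real.exp (y + e) - 1 - y ≤ (3 + 38 * Real.exp 8) * m := by
    have h := (abs_le.1 (abs_exp_sub_one_sub_le (y + e))).2
    have : (y + e) ^ 2 * Real.exp |y + e| ≤ 38 * m * Real.exp 8 := by gcongr
    linarith
  have hp := p₁_pos t
  have hlow : 1 + y - e ≤ Real.exp (y - e) := by linarith [Real.add_one_le_exp (y - e)]
  rw [abs_le]
  constructor
  · have h1 : p₁ t * (1 + y - e) ≤ w := le_trans (by gcongr) hl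
    have h2 : p₁ t * e ≤ p₁ t * (3 * m) := by gcongr
    have h3 : 0 ≤ 38 * Real.exp 8 * (p₁ t * m) := by positivity
    linarith
  · have h1 : p₁ t * (Real.exp (y + e) - 1 - y) ≤ p₁ t * ((3 + 38 * Real.exp 8) * m) := by gcongr
    linarith

/-- Now m ≥ 1, so no cancellation is needed: the weight and its approximant are each bounded by a
multiple of p₁(t) m. -/
lemma local_approx_of_large {b t w A : ℝ} (hb : 1 ≤ b) (htb : b ^ 4 ≤ t ^ 12)
    (hw : 0 ≤ w) (hA : 0 ≤ A) (hu : w ≤ A * p₁ t) :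
    |w - (p₁ t + p₂ t / b ^ 2)| ≤ (A + 3) * (p₁ t * ((1 + t ^ 12) / b ^ 4)) := by
  rw [p₁_add_p₂_div]
  have hb4 : 0 < b ^ 4 := by positivity
  obtain ⟨y, hy⟩ : ∃ y, y = (t ^ 2 / 2 - t ^ 6 / 30) / b ^ 2 := ⟨_, rfl⟩
  obtain ⟨m, hm⟩ : ∃ m, m = (1 + t ^ 12) / b ^ 4 := ⟨_, rfl⟩
  rw [← hy, ← hm]
  have hm1 : 1 ≤ m := by
    rw [hm, le_div_iff₀ hb4]
    linarith
  have hym : y ^ 2 ≤ m := by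
    rw [hy, hm, div_pow, ← pow_mul]
    gcongr
    exact sq_correction_le t
  have hp := p₁_pos t
  have h1 : A * p₁ t ≤ A * p₁ t * m := le_mul_of_one_le_right (by positivity) hm1
  have h2 : p₁ t * (1 + y) ≤ p₁ t * (3 * m) := by
    gcongr
    nlinarith [sq_nonneg (y - 1)]
  have h3 : p₁ t * (-3 * m) ≤ p₁ t * (1 + y) := by
    gcongr
    nlinarith [sq_nonneg (y + 1)]
  rw [abs_le]
  constructor <;> nlinarith [mul_pos hp (by linarith : 0 < m)]

/-- Here b = n^{1/4}, and (n + 1) / 2 is the first index with s ≥ 0. The common factor c is the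
weight there with its own phase removed. The clause on that weight later controls the middle term.
-/
lemma exists_latticeWeight_approx :
    ∃ K : ℝ, 0 < K ∧ ∀ n : ℕ, 64 ≤ n → ∀ b : ℝ, 0 < b → b ^ 4 = n → ∃ c : ℝ, 0 < c ∧
      latticeWeight n ((n + 1) / 2) ≤ K * c ∧
      ∀ k, (n + 1) / 2 ≤ k → ∀ t, t * b ^ 3 = 2 * k - n →
        |latticeWeight n k - c * (p₁ t + p₂ t / b ^ 2)|
          ≤ c * (K * (p₁ t * ((1 + t ^ 12) / b ^ 4))) := by
  refine ⟨3 + 38 * Real.exp 8 + (Real.exp 4 + 3), by positivity, fun n hn b hb hbn => ?_⟩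
  have hn' : (64 : ℝ) ≤ n := by exact_mod_cast hn
  have hb1 : 1 ≤ b := by
    by_contra! h
    have := pow_lt_one₀ hb.le h (n := 4) (by norm_num)
    linarith
  obtain ⟨k₀, hk₀⟩ : ∃ k₀, k₀ = (n + 1) / 2 := ⟨_, rfl⟩
  rw [← hk₀]
  obtain ⟨s₀, hs₀⟩ : ∃ s₀ : ℝ, s₀ = 2 * k₀ - n := ⟨_, rfl⟩
  have hs0 : 0 ≤ s₀ := by
    have : (n : ℝ) ≤ 2 * k₀ := by exact_mod_cast (by omega : n ≤ 2 * k₀)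
    linarith
  have hs1 : s₀ ≤ 1 := by
    have : 2 * (k₀ : ℝ) ≤ n + 1 := by exact_mod_cast (by omega : 2 * k₀ ≤ n + 1)
    linarith
  have hphase : phase n s₀ ≤ 1 := by
    have h1 : s₀ ^ 2 / (2 * (n : ℝ) ^ 2) ≤ 1 := by
      rw [div_le_one (by positivity)]
      nlinarith
    have h2 : 0 ≤ s₀ ^ 4 / (12 * (n : ℝ) ^ 3) := by positivity
    have h3 : 0 ≤ s₀ ^ 6 / (30 * (n : ℝ) ^ 5) := by positivity
    rw [phase]; linarith
  have herr : 0 ≤ phaseError n s₀ := by rw [phaseError]; positivity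
  have hw₀ : 0 < latticeWeight n k₀ := latticeWeight_pos (by omega)
  obtain ⟨c, hc⟩ : ∃ c, c = latticeWeight n k₀ * Real.exp (-phase n s₀) := ⟨_, rfl⟩
  have hc0 : 0 < c := by rw [hc]; positivity
  have hcw : latticeWeight n k₀ = c * Real.exp (phase n s₀) := by
    rw [hc, mul_assoc, ← Real.exp_add]; simp
  refine ⟨c, hc0, ?_, fun k hk t ht => ?_⟩
  · rw [hcw, mul_comm]
    gcongr
    have : Real.exp (phase n s₀) ≤ Real.exp 4 := Real.exp_le_exp.2 (by linarith)
    linarith [Real.exp_pos 8]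
  have hs : 0 ≤ 2 * (k : ℝ) - n := by
    have : (n : ℝ) ≤ 2 * k := by exact_mod_cast (by omega : n ≤ 2 * k)
    linarith
  have ht0 : 0 ≤ t := by
    by_contra! h
    have := mul_neg_of_neg_of_pos h (pow_pos hb 3)
    linarith
  have hscale : |latticeWeight n k - c * (p₁ t + p₂ t / b ^ 2)|
      = c * |latticeWeight n k / c - (p₁ t + p₂ t / b ^ 2)| := by
    rw [← abs_of_pos hc0, ← abs_mul, abs_of_pos hc0, mul_sub, mul_div_cancel₀ _ hc0.ne']
  rw [hscale]
  have hM : 0 ≤ p₁ t * ((1 + t ^ 12) / b ^ 4) :=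
    mul_nonneg (p₁_pos t).le (by positivity)
  gcongr
  rcases le_total (t ^ 12) (b ^ 4) with htb | htb
  -- This is where n ≥ 64 enters: (b/2)¹² = b⁴n²/4096 ≥ b⁴, since 64² = 2¹².
  · have htb2 : t ≤ b / 2 := by
      by_contra! h
      have h1 := pow_le_pow_left₀ (by positivity) h.le 12
      have h2 : b ^ 12 = b ^ 4 * (n : ℝ) ^ 2 := by rw [← hbn]; ring
      have h3 : b ^ 4 * 4096 < b ^ 12 ∨ b ^ 4 * 4096 = b ^ 12 := by
        rw [← le_iff_lt_or_eq, h2]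
        gcongr
        nlinarith
      have h5 : (b / 2) ^ 12 < t ^ 12 := pow_lt_pow_left₀ h (by positivity) (by norm_num)
      have h6 : (b / 2) ^ 12 = b ^ 12 / 4096 := by ring
      rcases h3 with h3 | h3 <;> linarith
    have hsn : 2 * (k : ℝ) - n ≤ n / 2 := by
      rw [← ht, ← hbn]
      calc t * b ^ 3 ≤ b / 2 * b ^ 3 := by gcongr
        _ = _ := by ring
    have h := latticeWeight_bounds (by omega) (by omega : n ≤ 2 * k₀) hk hsn
    rw [← hs₀, ← ht, hcw] at h
    have e1 : phase n (t * b ^ 3) = -t ^ 4 / 12 + (t ^ 2 / 2 - t ^ 6 / 30) / b ^ 2 := by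
      rw [phase, ← hbn]; field_simp; ring
    have e2 : phaseError n (t * b ^ 3) = t ^ 2 / b ^ 6 + t ^ 4 / b ^ 4 + t ^ 8 / b ^ 4 := by
      rw [phaseError, ← hbn]; field_simp
    refine (local_approx_of_small hb1 ht0 htb ?_ ?_).trans ?_
    · rw [le_div_iff₀ hc0]
      refine le_trans ?_ h.1
      rw [p₁, mul_comm, ← Real.exp_add, mul_assoc, ← Real.exp_add, ← e2]
      refine mul_le_mul_of_nonneg_left (Real.exp_le_exp.2 ?_) hc0.le
      rw [e1]
      linarith
    · rw [div_le_iff₀ hc0]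
      refine h.2.trans ?_
      rw [p₁, mul_comm _ c, ← Real.exp_add, mul_assoc, ← Real.exp_add, ← e2]
      refine mul_le_mul_of_nonneg_left (Real.exp_le_exp.2 ?_) hc0.le
      rw [e1]
      linarith
    · exact mul_le_mul_of_nonneg_right (by linarith [Real.exp_pos 4]) hM
  · refine (local_approx_of_large hb1 htb (div_nonneg (latticeWeight_nonneg _ _) hc0.le)
      (Real.exp_pos 4).le ?_).trans ?_
    · rcases lt_or_ge n k with hkn | hkn
      · rw [latticeWeight_of_lt hkn, zero_div]
        exact mul_nonneg (Real.exp_pos _).le (p₁_pos t).le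
      · rw [div_le_iff₀ hc0]
        have h := latticeWeight_le (by omega) (by omega : n ≤ 2 * k₀) hk
        rw [← hs₀, hcw] at h
        refine h.trans ?_
        rw [p₁, mul_comm _ c, ← Real.exp_add, mul_assoc, ← Real.exp_add]
        refine mul_le_mul_of_nonneg_left (Real.exp_le_exp.2 ?_) hc0.le
        -- Beyond -t⁴/12 the exponent is at most 2 + 1 + 1, from 2s²/n², the s₀⁴ term and the phase
        -- at s₀; hence the factor exp 4.
        have h1 : 2 * (2 * (k : ℝ) - n) ^ 2 / (n : ℝ) ^ 2 ≤ 2 := by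
          have : (k : ℝ) ≤ n := by exact_mod_cast hkn
          rw [div_le_iff₀ (by positivity)]
          gcongr
          linarith
        have h2 : (2 * (k : ℝ) - n) ^ 4 / (12 * (n : ℝ) ^ 3) = t ^ 4 / 12 := by
          rw [← ht, ← hbn]; field_simp
        have h3 : s₀ ^ 4 / (12 * (n : ℝ) ^ 3) ≤ 1 := by
          rw [div_le_one (by positivity)]
          have : s₀ ^ 4 ≤ 1 := pow_le_one₀ hs0 hs1
          have : (1 : ℝ) ≤ (n : ℝ) ^ 3 := one_le_pow₀ (by linarith)
          linarith
        have h4 : 0 ≤ 2 * s₀ ^ 2 / (n : ℝ) ^ 2 := by positivity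
        rw [h2]
        linarith
    · exact mul_le_mul_of_nonneg_right (by linarith [Real.exp_pos 8]) hM

/-! ### Tail moments of the limiting density -/

section TailMoments

open MeasureTheory Set Filter Topology intervalIntegral

/-- The upper tail moments of the unnormalized limiting density. -/
def tailMoment (k : ℕ) (x : ℝ) : ℝ := ∫ t in Ioi x, t ^ k * p₁ t

lemma continuous_pow_mul_p₁ (k : ℕ) : Continuous fun t : ℝ => t ^ k * p₁ t := by
  unfold p₁; fun_prop

lemma integrable_pow_mul_p₁ (k : ℕ) : Integrable fun t : ℝ => t ^ k * p₁ t := by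
  have h := (integrable_rpow_mul_exp_neg_mul_sq (b := 1) one_pos (s := k)
    (by linarith [(k.cast_nonneg : (0 : ℝ) ≤ k)])).const_mul (Real.exp 3)
  refine h.mono (continuous_pow_mul_p₁ k).aestronglyMeasurable (Eventually.of_forall fun t => ?_)
  have h1 : p₁ t ≤ Real.exp 3 * Real.exp (-1 * t ^ 2) := by
    rw [p₁, ← Real.exp_add]
    gcongr
    -- The square gives -t⁴/12 ≤ 3 - t², a Gaussian majorant.
    nlinarith [sq_nonneg (t ^ 2 - 6)]
  rw [Real.rpow_natCast, norm_mul, norm_mul, norm_mul, Real.norm_of_nonneg (p₁_pos t).le,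
    Real.norm_of_nonneg (Real.exp_pos _).le, Real.norm_of_nonneg (Real.exp_pos _).le]
  calc ‖t ^ k‖ * p₁ t ≤ ‖t ^ k‖ * (Real.exp 3 * Real.exp (-1 * t ^ 2)) := by gcongr
    _ = _ := by ring

lemma integrable_p₁ : Integrable p₁ := by
  simpa using integrable_pow_mul_p₁ 0

lemma p₂_eq (t : ℝ) : p₂ t = 1 / 2 * (t ^ 2 * p₁ t) - 1 / 30 * (t ^ 6 * p₁ t) := by
  rw [p₁, p₂]; ring

lemma tailMoment_zero (x : ℝ) : tailMoment 0 x = ∫ t in Ioi x, p₁ t := by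
  simp [tailMoment]

lemma setIntegral_p₂ (x : ℝ) :
    ∫ t in Ioi x, p₂ t = 1 / 2 * tailMoment 2 x - 1 / 30 * tailMoment 6 x := by
  simp_rw [p₂_eq]
  rw [integral_sub ((integrable_pow_mul_p₁ 2).const_mul _).integrableOn
    ((integrable_pow_mul_p₁ 6).const_mul _).integrableOn, MeasureTheory.integral_const_mul, MeasureTheory.integral_const_mul]
  rfl

lemma tailMoment_zero_pos (x : ℝ) : 0 < tailMoment 0 x := by
  rw [tailMoment_zero]
  refine (setIntegral_pos_iff_support_of_nonneg_ae (Eventually.of_forall fun t => (p₁_pos t).le)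
    integrable_p₁.integrableOn).2 ?_
  have : Function.support p₁ = univ := by
    ext t; simp [(p₁_pos t).ne']
  simp [this]

lemma tailMoment_nonneg {x : ℝ} (hx : 0 ≤ x) (k : ℕ) : 0 ≤ tailMoment k x :=
  setIntegral_nonneg measurableSet_Ioi fun t ht =>
    mul_nonneg (pow_nonneg (hx.trans (le_of_lt ht)) k) (p₁_pos t).le

/-- Since (2t)⁴/12 = t⁴ + t⁴/3, doubling the argument leaves a spare exp (-t⁴) to absorb the power
of t. -/
lemma pow_mul_p₁_two_mul_le (k : ℕ) {t : ℝ} (ht : 0 ≤ t) :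
    (2 * t) ^ k * p₁ (2 * t) ≤ 2 ^ k * (1 + k.factorial) * (t ^ 0 * p₁ t) := by
  have h1 : t ^ k ≤ 1 + k.factorial * Real.exp (t ^ 4) := by
    have h := Real.pow_div_factorial_le_exp (t ^ 4) (by positivity) k
    rw [div_le_iff₀ (by positivity), ← pow_mul] at h
    have := pow_le_one_add_pow ht (by omega : k ≤ 4 * k)
    linarith
  have h2 : t ^ k ≤ (1 + k.factorial) * Real.exp (t ^ 4) := by
    have : 1 ≤ Real.exp (t ^ 4) := Real.one_le_exp (by positivity)
    linarith
  have h3 : p₁ (2 * t) ≤ Real.exp (-t ^ 4) * p₁ t := by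
    rw [p₁, p₁, ← Real.exp_add]
    gcongr
    have : 0 ≤ t ^ 4 := by positivity
    linarith [show (2 * t) ^ 4 = 16 * t ^ 4 by ring]
  calc (2 * t) ^ k * p₁ (2 * t)
      ≤ (2 ^ k * ((1 + k.factorial) * Real.exp (t ^ 4))) * (Real.exp (-t ^ 4) * p₁ t) := by
        rw [mul_pow]
        gcongr
        exact (p₁_pos _).le
    _ = 2 ^ k * (1 + k.factorial) * (Real.exp (t ^ 4) * Real.exp (-t ^ 4)) * p₁ t := by ring
    _ = _ := by rw [← Real.exp_add]; simp

/-- Split at 2x: up to 2x the power is at most (2x)^k, and beyond it the substitution t ↦ 2t brings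
the integral back to the tail from x. -/
lemma tailMoment_le (k : ℕ) :
    ∃ K : ℝ, 0 < K ∧ ∀ x, 0 ≤ x → tailMoment k x ≤ K * (1 + x ^ k) * tailMoment 0 x := by
  refine ⟨2 ^ k + 2 * (2 ^ k * (1 + k.factorial)), by positivity, fun x hx => ?_⟩
  have hT := (tailMoment_zero_pos x).le
  have hi : ∀ j (s : Set ℝ), IntegrableOn (fun t : ℝ => t ^ j * p₁ t) s :=
    fun j s => (integrable_pow_mul_p₁ j).integrableOn
  have hsplit : tailMoment k x
      = (∫ t in Ioc x (2 * x), t ^ k * p₁ t) + ∫ t in Ioi (2 * x), t ^ k * p₁ t := by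
    rw [← setIntegral_union (Ioc_disjoint_Ioi le_rfl) measurableSet_Ioi (hi _ _) (hi _ _),
      Ioc_union_Ioi_eq_Ioi (by linarith)]
    rfl
  have h1 : ∫ t in Ioc x (2 * x), t ^ k * p₁ t ≤ (2 * x) ^ k * tailMoment 0 x := by
    calc ∫ t in Ioc x (2 * x), t ^ k * p₁ t
        ≤ ∫ t in Ioc x (2 * x), (2 * x) ^ k * (t ^ 0 * p₁ t) := by
          refine setIntegral_mono_on (hi _ _) ((hi _ _).const_mul _) measurableSet_Ioc
            fun t ht => ?_
          rw [pow_zero, one_mul]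
          gcongr
          · exact (p₁_pos t).le
          · exact hx.trans ht.1.le
          · exact ht.2
      _ = (2 * x) ^ k * ∫ t in Ioc x (2 * x), t ^ 0 * p₁ t := MeasureTheory.integral_const_mul _ _
      _ ≤ _ := by
          gcongr
          refine setIntegral_mono_set (hi _ _) (Eventually.of_forall fun t => ?_)
            (Eventually.of_forall fun t ht => ht.1)
          simpa using (p₁_pos t).le
  have h2 : ∫ t in Ioi (2 * x), t ^ k * p₁ t
      ≤ 2 * (2 ^ k * (1 + k.factorial)) * tailMoment 0 x := by
    have h := integral_comp_mul_left_Ioi (fun t : ℝ => t ^ k * p₁ t) x two_pos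
    rw [smul_eq_mul] at h
    have h' : ∫ t in Ioi x, (2 * t) ^ k * p₁ (2 * t)
        ≤ ∫ t in Ioi x, 2 ^ k * (1 + k.factorial) * (t ^ 0 * p₁ t) := by
      refine setIntegral_mono_on ?_ ((hi _ _).const_mul _) measurableSet_Ioi
        fun t ht => pow_mul_p₁_two_mul_le k (hx.trans (le_of_lt ht))
      exact ((integrable_pow_mul_p₁ k).comp_mul_left' two_ne_zero).integrableOn
    rw [MeasureTheory.integral_const_mul, h] at h'
    unfold tailMoment
    linarith
  have h3 : 0 ≤ 2 * (2 ^ k * (1 + (k.factorial : ℝ))) * x ^ k * tailMoment 0 x := by positivity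
  have h4 : 0 ≤ 2 ^ k * tailMoment 0 x := by positivity
  rw [mul_pow] at h1
  rw [hsplit]
  linarith

/-! ### Riemann sums against tail integrals -/

section RiemannSum

variable {f f' : ℝ → ℝ}

lemma abs_mul_sub_integral_le (hf : ∀ t, HasDerivAt f (f' t) t) (hf' : Continuous f')
    (a : ℝ) {δ : ℝ} (hδ : 0 ≤ δ) :
    |δ * f a - ∫ t in a..a + δ, f t| ≤ δ * ∫ t in a..a + δ, |f' t| := by
  have hcf : Continuous f := continuous_iff_continuousAt.2 fun t => (hf t).continuousAt
  have e : δ * f a - ∫ t in a..a + δ, f t = ∫ t in a..a + δ, (f a - f t) := by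
    rw [integral_sub (by simp) (hcf.intervalIntegrable _ _)]
    simp
  rw [e]
  have h := norm_integral_le_of_norm_le_const (a := a) (b := a + δ)
    (f := fun t => f a - f t) (C := ∫ t in a..a + δ, |f' t|) fun t ht => ?_
  · simpa [abs_of_nonneg hδ, mul_comm] using h
  · rw [uIoc_of_le (by linarith)] at ht
    have h1 := integral_eq_sub_of_hasDerivAt (a := a) (b := t) (fun s _ => hf s)
      (hf'.intervalIntegrable _ _)
    rw [norm_sub_rev, ← h1, Real.norm_eq_abs]
    refine (abs_integral_le_integral_abs ht.1.le).trans ?_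
    exact integral_mono_interval le_rfl ht.1.le ht.2
      (Eventually.of_forall fun s => abs_nonneg _) (hf'.abs.intervalIntegrable _ _)

lemma abs_sum_sub_integral_le (hf : ∀ t, HasDerivAt f (f' t) t) (hf' : Continuous f')
    (a : ℝ) {δ : ℝ} (hδ : 0 ≤ δ) (M : ℕ) :
    |δ * ∑ i ∈ Finset.range M, f (a + i * δ) - ∫ t in a..a + M * δ, f t|
      ≤ δ * ∫ t in a..a + M * δ, |f' t| := by
  have hcf : Continuous f := continuous_iff_continuousAt.2 fun t => (hf t).continuousAt
  induction M with
  | zero => simp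
  | succ M ih =>
    have e : a + ((M + 1 : ℕ) : ℝ) * δ = (a + M * δ) + δ := by push_cast; ring
    rw [e, Finset.sum_range_succ, ← integral_add_adjacent_intervals (b := a + M * δ)
      (hcf.intervalIntegrable _ _) (hcf.intervalIntegrable _ _),
      ← integral_add_adjacent_intervals (a := a) (b := a + M * δ)
      (hf'.abs.intervalIntegrable _ _) (hf'.abs.intervalIntegrable _ _)]
    have h := abs_mul_sub_integral_le hf hf' (a + M * δ) hδ
    calc _ = |(δ * ∑ i ∈ Finset.range M, f (a + i * δ) - ∫ t in a..a + M * δ, f t)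
          + (δ * f (a + M * δ) - ∫ t in (a + M * δ)..(a + M * δ) + δ, f t)| := by
          congr 1; ring
      _ ≤ _ := (abs_add_le _ _).trans (by linarith)

/-- One δ∫|f'| is the Riemann error from a onwards. The other covers the gap from x to a, where |f|
is at most ∫|f'| because f tends to 0 at infinity. -/
lemma abs_sum_sub_integral_le_of_integrableOn (hf : ∀ t, HasDerivAt f (f' t) t)
    (hf' : Continuous f') {x : ℝ} (hfi : IntegrableOn f (Ioi x)) (hfi' : IntegrableOn f' (Ioi x))
    {a δ : ℝ} (hδ : 0 ≤ δ) (hxa : x ≤ a) (hax : a ≤ x + δ) (M : ℕ) :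
    |δ * ∑ i ∈ Finset.range M, f (a + i * δ) - ∫ t in x..a + M * δ, f t|
      ≤ 2 * δ * ∫ t in Ioi x, |f' t| := by
  have hcf : Continuous f := continuous_iff_continuousAt.2 fun t => (hf t).continuousAt
  have hlim := tendsto_zero_of_hasDerivAt_of_integrableOn_Ioi (fun t _ => hf t) hfi' hfi
  have hle : ∀ y z, x ≤ y → y ≤ z → ∫ t in y..z, |f' t| ≤ ∫ t in Ioi x, |f' t| := by
    intro y z hy hz
    rw [integral_of_le hz]
    exact setIntegral_mono_set hfi'.abs (Eventually.of_forall fun t => abs_nonneg _)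
      (Eventually.of_forall fun t ht => lt_of_le_of_lt hy ht.1)
  have hsup : ∀ t, x ≤ t → |f t| ≤ ∫ t in Ioi x, |f' t| := by
    intro t ht
    have h1 := integral_Ioi_of_hasDerivAt_of_tendsto' (a := t) (fun s _ => hf s)
      (hfi'.mono_set (Ioi_subset_Ioi ht)) hlim
    rw [zero_sub] at h1
    rw [← abs_neg, ← h1]
    refine MeasureTheory.abs_integral_le_integral_abs.trans ?_
    exact setIntegral_mono_set hfi'.abs (Eventually.of_forall fun t => abs_nonneg _)
      (Eventually.of_forall (Ioi_subset_Ioi ht))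
  have hgap : |∫ t in x..a, f t| ≤ δ * ∫ t in Ioi x, |f' t| := by
    have h := norm_integral_le_of_norm_le_const (a := x) (b := a)
      (f := f) (C := ∫ t in Ioi x, |f' t|) fun t ht => by
        rw [uIoc_of_le hxa] at ht
        exact hsup t ht.1.le
    rw [Real.norm_eq_abs, abs_of_nonneg (sub_nonneg.2 hxa), mul_comm] at h
    refine h.trans ?_
    exact mul_le_mul_of_nonneg_right (by linarith)
      (MeasureTheory.integral_nonneg fun t => abs_nonneg _)
  have hM : 0 ≤ (M : ℝ) * δ := by positivity
  have hmain := (abs_sum_sub_integral_le hf hf' a hδ M).trans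
    (mul_le_mul_of_nonneg_left (hle a (a + M * δ) hxa (by linarith)) hδ)
  rw [← integral_add_adjacent_intervals (b := a) (hcf.intervalIntegrable _ _)
    (hcf.intervalIntegrable _ _)]
  rw [abs_le] at *
  constructor <;> linarith [hgap.1, hgap.2, hmain.1, hmain.2]

end RiemannSum

lemma hasDerivAt_pow_mul_p₁ (k : ℕ) (t : ℝ) :
    HasDerivAt (fun t : ℝ => t ^ k * p₁ t)
      (k * (t ^ (k - 1) * p₁ t) - 1 / 3 * (t ^ (k + 3) * p₁ t)) t := by
  have h : HasDerivAt p₁ (Real.exp (-t ^ 4 / 12) * (-(4 * t ^ 3) / 12)) t := by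
    have : HasDerivAt (fun t : ℝ => Real.exp (-t ^ 4 / 12))
        (Real.exp (-t ^ 4 / 12) * (-(4 * t ^ 3) / 12)) t := by
      simpa using (((hasDerivAt_pow 4 t).neg).div_const 12).exp
    exact this
  refine ((hasDerivAt_pow k t).mul h).congr_deriv ?_
  simp only [p₁]
  ring

/-- Differentiating p₁ raises the degree by 3, so `tailMoment_le` at k + 3 turns the total variation
into a multiple of the tail itself. -/
lemma exists_abs_sum_pow_mul_p₁_sub_integral_le (k : ℕ) :
    ∃ K : ℝ, 0 < K ∧ ∀ x, 0 ≤ x → ∀ δ, 0 ≤ δ → ∀ a, x ≤ a → a ≤ x + δ → ∀ M : ℕ,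
      |δ * ∑ i ∈ Finset.range M, (a + i * δ) ^ k * p₁ (a + i * δ)
          - ∫ t in x..a + M * δ, t ^ k * p₁ t|
        ≤ K * (δ * (1 + x ^ (k + 3))) * tailMoment 0 x := by
  obtain ⟨K, hK, h⟩ := tailMoment_le (k + 3)
  refine ⟨2 * (k + (k + 1) * K), by positivity, fun x hx δ hδ a hxa hax M => ?_⟩
  have hT := (tailMoment_zero_pos x).le
  have hint : Integrable fun t : ℝ =>
      k * (t ^ (k - 1) * p₁ t) - 1 / 3 * (t ^ (k + 3) * p₁ t) :=
    ((integrable_pow_mul_p₁ _).const_mul _).sub ((integrable_pow_mul_p₁ _).const_mul _)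
  have hcont : Continuous fun t : ℝ =>
      k * (t ^ (k - 1) * p₁ t) - 1 / 3 * (t ^ (k + 3) * p₁ t) :=
    ((continuous_pow_mul_p₁ _).const_mul _).sub ((continuous_pow_mul_p₁ _).const_mul _)
  refine (abs_sum_sub_integral_le_of_integrableOn (hasDerivAt_pow_mul_p₁ k) hcont
    (integrable_pow_mul_p₁ k).integrableOn hint.integrableOn hδ hxa hax M).trans ?_
  have h1 : ∫ t in Ioi x, |k * (t ^ (k - 1) * p₁ t) - 1 / 3 * (t ^ (k + 3) * p₁ t)|
      ≤ k * tailMoment 0 x + (k + 1) * tailMoment (k + 3) x := by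
    rw [tailMoment, tailMoment, ← MeasureTheory.integral_const_mul, ← MeasureTheory.integral_const_mul, ← integral_add
      ((integrable_pow_mul_p₁ _).const_mul _).integrableOn
      ((integrable_pow_mul_p₁ _).const_mul _).integrableOn]
    refine setIntegral_mono_on hint.abs.integrableOn
      (((integrable_pow_mul_p₁ _).const_mul _).add
        ((integrable_pow_mul_p₁ _).const_mul _)).integrableOn measurableSet_Ioi fun t ht => ?_
    have ht0 : 0 ≤ t := hx.trans (le_of_lt ht)
    have hp := (p₁_pos t).le
    have h2 : (k : ℝ) * (t ^ (k - 1) * p₁ t) ≤ k * ((1 + t ^ (k + 3)) * p₁ t) := by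
      gcongr
      exact pow_le_one_add_pow ht0 (by omega)
    have h3 : 0 ≤ (k : ℝ) * (t ^ (k - 1) * p₁ t) := by positivity
    have h4 : 0 ≤ t ^ (k + 3) * p₁ t := by positivity
    have h5 : 0 ≤ (k : ℝ) * (t ^ (k + 3) * p₁ t) := by positivity
    have h6 : 0 ≤ (k : ℝ) * p₁ t := by positivity
    rw [abs_le]
    constructor <;> simp only [pow_zero, one_mul] <;> linarith
  have h2 := h x hx
  have h3 : k * tailMoment 0 x + (k + 1) * tailMoment (k + 3) x
      ≤ (k + (k + 1) * K) * (1 + x ^ (k + 3)) * tailMoment 0 x := by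
    have h4 : (k + 1) * tailMoment (k + 3) x
      ≤ (k + 1) * (K * (1 + x ^ (k + 3)) * tailMoment 0 x) := by gcongr
    have h5 : 0 ≤ k * x ^ (k + 3) * tailMoment 0 x := by positivity
    linarith
  calc _ ≤ 2 * δ * ((k + (k + 1) * K) * (1 + x ^ (k + 3)) * tailMoment 0 x) := by
        gcongr
        exact h1.trans h3
    _ = _ := by ring

end TailMoments

/-! ### Tail sums of the weights -/

section TailSums

open MeasureTheory Set Filter Topology

/-- With d = n^{1/12} all exponents become integers: the spacing is 2/d⁹, √n = d⁶, and the target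
error is (x¹² + d⁴)/d¹². -/
lemma scaled_error_bounds {d x : ℝ} (hd : 1 ≤ d) (hx : 0 ≤ x) (hxd : x ≤ d) :
    2 / d ^ 9 * (1 + x ^ 3) ≤ 4 * ((x ^ 12 + d ^ 4) / d ^ 12) ∧
    2 / d ^ 9 * (1 + x ^ 3) ≤ 4 ∧
    2 / d ^ 9 * (1 + x ^ 5) / d ^ 6 ≤ 4 * ((x ^ 12 + d ^ 4) / d ^ 12) ∧
    2 / d ^ 9 * (1 + x ^ 9) / d ^ 6 ≤ 4 * ((x ^ 12 + d ^ 4) / d ^ 12) ∧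
    2 / d ^ 9 * (1 + x ^ 15) / d ^ 12 ≤ 2 * ((x ^ 12 + d ^ 4) / d ^ 12) ∧
    (1 + x ^ 12) / d ^ 12 ≤ (x ^ 12 + d ^ 4) / d ^ 12 ∧
    1 / d ^ 12 ≤ (x ^ 12 + d ^ 4) / d ^ 12 := by
  have hd0 : 0 < d := by linarith
  have h4 : 1 ≤ d ^ 4 := one_le_pow₀ hd
  have h34 : d ^ 3 ≤ d ^ 4 := pow_le_pow_right₀ hd (by norm_num)
  have hx12 : 0 ≤ x ^ 12 := by positivity
  have hd3 : 1 ≤ d ^ 3 := one_le_pow₀ hd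
  -- This is the Riemann error x³n^{-3/4}: the two cases compare it with d⁴ and x¹² respectively.
  have hmul : x ^ 3 * d ^ 3 ≤ x ^ 12 + d ^ 4 := by
    rcases le_total (x ^ 3) d with h | h
    · have : x ^ 3 * d ^ 3 ≤ d * d ^ 3 := by gcongr
      linarith [show d * d ^ 3 = d ^ 4 by ring]
    · have : x ^ 3 * d ^ 3 ≤ x ^ 3 * (x ^ 3) ^ 3 := by gcongr
      linarith [show x ^ 3 * (x ^ 3) ^ 3 = x ^ 12 by ring, (by positivity : 0 ≤ d ^ 4)]
  have h15 : ∀ j ≤ 12, 2 / d ^ 9 * (1 + x ^ j) / d ^ 6 ≤ 4 * ((x ^ 12 + d ^ 4) / d ^ 12) := by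
    intro j hj
    have := pow_le_one_add_pow hx hj
    calc 2 / d ^ 9 * (1 + x ^ j) / d ^ 6 = 2 * (1 + x ^ j) / (d ^ 12 * d ^ 3) := by
          field_simp
      _ ≤ 2 * (1 + (1 + x ^ 12)) / (d ^ 12 * 1) := by gcongr
      _ ≤ 4 * (x ^ 12 + d ^ 4) / (d ^ 12 * 1) := by gcongr ?_ / _; linarith
      _ = _ := by ring
  refine ⟨?_, ?_, h15 5 (by norm_num), h15 9 (by norm_num), ?_, ?_, ?_⟩
  · calc 2 / d ^ 9 * (1 + x ^ 3) = 2 * (d ^ 3 + x ^ 3 * d ^ 3) / d ^ 12 := by field_simp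
      _ ≤ 4 * (x ^ 12 + d ^ 4) / d ^ 12 := by gcongr ?_ / _; linarith
      _ = _ := by ring
  · have h1 : x ^ 3 ≤ d ^ 9 :=
      (pow_le_pow_left₀ hx hxd 3).trans (pow_le_pow_right₀ hd (by norm_num))
    have h2 : 1 ≤ d ^ 9 := one_le_pow₀ hd
    rw [div_mul_eq_mul_div, div_le_iff₀ (by positivity)]
    linarith
  · have h1 : x ^ 15 ≤ x ^ 12 * d ^ 9 := by
      calc x ^ 15 = x ^ 12 * x ^ 3 := by ring
        _ ≤ x ^ 12 * d ^ 9 := by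
          gcongr
          exact (pow_le_pow_left₀ hx hxd 3).trans (pow_le_pow_right₀ hd (by norm_num))
    have h2 : 1 ≤ d ^ 9 := one_le_pow₀ hd
    rw [← mul_div_assoc]
    gcongr ?_ / _
    rw [div_mul_eq_mul_div, div_le_iff₀ (by positivity)]
    nlinarith [mul_le_mul h4 h2 (by norm_num) (by positivity)]
  · gcongr ?_ / _; linarith
  · gcongr ?_ / _; linarith

lemma exists_tail_sum_approx {K₀ : ℝ} (hK₀ : 0 ≤ K₀) :
    ∃ K : ℝ, 0 < K ∧ ∀ d x a S : ℝ, ∀ w : ℕ → ℝ, 1 ≤ d → 0 ≤ x → x ≤ d → x ≤ a →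
      a ≤ x + 2 / d ^ 9 →
      (∀ i : ℕ, ∀ t, t = a + i * (2 / d ^ 9) →
        |w i - (p₁ t + p₂ t / d ^ 6)| ≤ K₀ * (p₁ t * ((1 + t ^ 12) / d ^ 12))) →
      (∀ᶠ M in atTop, ∑ i ∈ Finset.range M, w i = S) →
      |2 / d ^ 9 * S - (tailMoment 0 x + (∫ t in Ioi x, p₂ t) / d ^ 6)|
        ≤ K * ((x ^ 12 + d ^ 4) / d ^ 12) * tailMoment 0 x := by
  obtain ⟨R0, hR0, h0⟩ := exists_abs_sum_pow_mul_p₁_sub_integral_le 0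
  obtain ⟨R2, hR2, h2⟩ := exists_abs_sum_pow_mul_p₁_sub_integral_le 2
  obtain ⟨R6, hR6, h6⟩ := exists_abs_sum_pow_mul_p₁_sub_integral_le 6
  obtain ⟨R12, hR12, h12⟩ := exists_abs_sum_pow_mul_p₁_sub_integral_le 12
  obtain ⟨Q, hQ, hQ12⟩ := tailMoment_le 12
  refine ⟨K₀ * (1 + 4 * R0 + (Q + 2 * R12)) + 4 * R0 + 4 * R2 + 4 * R6, by positivity,
    fun d x a S w hd hx hxd hxa hax hw hS => ?_⟩
  obtain ⟨b0, b0', b2, b6, b12, bq, b1⟩ := scaled_error_bounds hd hx hxd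
  obtain ⟨δ, hδ⟩ : ∃ δ, δ = 2 / d ^ 9 := ⟨_, rfl⟩
  obtain ⟨ε, hε⟩ : ∃ ε, ε = (x ^ 12 + d ^ 4) / d ^ 12 := ⟨_, rfl⟩
  rw [← hδ] at b0 b0' b2 b6 b12 hax hw ⊢
  rw [← hε] at b0 b2 b6 b12 bq b1 ⊢
  have hd0 : 0 < d := by linarith
  have hδ0 : 0 ≤ δ := by rw [hδ]; positivity
  have hT := (tailMoment_zero_pos x).le
  have hTε : 0 ≤ ε * tailMoment 0 x := mul_nonneg (by rw [hε]; positivity) hT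
  have hend : Tendsto (fun M : ℕ => a + M * δ) atTop atTop :=
    tendsto_atTop_add_const_left _ _ (tendsto_natCast_atTop_atTop.atTop_mul_const
      (by rw [hδ]; positivity))
  have hI : ∀ k, Tendsto (fun M : ℕ => ∫ t in x..a + M * δ, t ^ k * p₁ t) atTop
      (𝓝 (tailMoment k x)) := fun k =>
    intervalIntegral_tendsto_integral_Ioi x (integrable_pow_mul_p₁ k).integrableOn hend
  have hIle : ∀ k (M : ℕ), ∫ t in x..a + M * δ, t ^ k * p₁ t ≤ tailMoment k x := by
    intro k M
    have : 0 ≤ (M : ℝ) * δ := by positivity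
    rw [intervalIntegral.integral_of_le (by linarith)]
    refine setIntegral_mono_set (integrable_pow_mul_p₁ k).integrableOn ?_
      (Eventually.of_forall fun t ht => ht.1)
    exact (ae_restrict_iff' measurableSet_Ioi).2 (Eventually.of_forall fun t ht =>
      mul_nonneg (pow_nonneg (hx.trans (le_of_lt ht)) k) (p₁_pos t).le)
  have hlim : Tendsto (fun M : ℕ => |δ * S - ((∫ t in x..a + M * δ, t ^ 0 * p₁ t)
      + (1 / 2 * (∫ t in x..a + M * δ, t ^ 2 * p₁ t)
        - 1 / 30 * ∫ t in x..a + M * δ, t ^ 6 * p₁ t) / d ^ 6)|) atTop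
      (𝓝 |δ * S - (tailMoment 0 x + (∫ t in Ioi x, p₂ t) / d ^ 6)|) := by
    rw [setIntegral_p₂]
    exact (tendsto_const_nhds.sub ((hI 0).add
      ((((hI 2).const_mul _).sub ((hI 6).const_mul _)).div_const _))).abs
  -- The sum is eventually S, so only the upper limit of the integrals moves; a bound uniform in M
  -- passes to the limit.
  refine le_of_tendsto hlim ?_
  filter_upwards [hS] with M hM
  have e0 := h0 x hx δ hδ0 a hxa hax M
  have e2 := h2 x hx δ hδ0 a hxa hax M
  have e6 := h6 x hx δ hδ0 a hxa hax M
  have e12 := h12 x hx δ hδ0 a hxa hax M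
  have i0 := hIle 0 M
  have i12 := (hIle 12 M).trans (hQ12 x hx)
  have hsum : |δ * S - δ * ∑ i ∈ Finset.range M, (p₁ (a + i * δ) + p₂ (a + i * δ) / d ^ 6)|
      ≤ K₀ * ((δ * ∑ i ∈ Finset.range M, (a + i * δ) ^ 0 * p₁ (a + i * δ)
        + δ * ∑ i ∈ Finset.range M, (a + i * δ) ^ 12 * p₁ (a + i * δ)) / d ^ 12) := by
    rw [← hM, ← mul_sub, ← Finset.sum_sub_distrib, abs_mul, abs_of_nonneg hδ0]
    calc δ * |∑ i ∈ Finset.range M, (w i - (p₁ (a + i * δ) + p₂ (a + i * δ) / d ^ 6))|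
        ≤ δ * ∑ i ∈ Finset.range M, K₀ * (p₁ (a + i * δ) * ((1 + (a + i * δ) ^ 12) / d ^ 12)) := by
          gcongr
          exact (Finset.abs_sum_le_sum_abs _ _).trans (Finset.sum_le_sum fun i _ => hw i _ rfl)
      _ = _ := by
          rw [← mul_add, ← Finset.sum_add_distrib, ← mul_div_assoc, mul_div_right_comm,
            mul_left_comm, ← mul_assoc, Finset.mul_sum, Finset.mul_sum]
          refine Finset.sum_congr rfl fun i _ => ?_
          ring
  have hsplit : δ * ∑ i ∈ Finset.range M, (p₁ (a + i * δ) + p₂ (a + i * δ) / d ^ 6)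
      = δ * ∑ i ∈ Finset.range M, (a + i * δ) ^ 0 * p₁ (a + i * δ)
        + (1 / 2 * (δ * ∑ i ∈ Finset.range M, (a + i * δ) ^ 2 * p₁ (a + i * δ))
          - 1 / 30 * (δ * ∑ i ∈ Finset.range M, (a + i * δ) ^ 6 * p₁ (a + i * δ))) / d ^ 6 := by
    simp only [Finset.mul_sum, ← Finset.sum_sub_distrib, Finset.sum_div, ← Finset.sum_add_distrib]
    refine Finset.sum_congr rfl fun i _ => ?_
    rw [p₂_eq]
    ring
  rw [hsplit] at hsum
  generalize δ * ∑ i ∈ Finset.range M, (a + i * δ) ^ 0 * p₁ (a + i * δ) = s0 at *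
  generalize δ * ∑ i ∈ Finset.range M, (a + i * δ) ^ 2 * p₁ (a + i * δ) = s2 at *
  generalize δ * ∑ i ∈ Finset.range M, (a + i * δ) ^ 6 * p₁ (a + i * δ) = s6 at *
  generalize δ * ∑ i ∈ Finset.range M, (a + i * δ) ^ 12 * p₁ (a + i * δ) = s12 at *
  generalize ∫ t in x..a + M * δ, t ^ 0 * p₁ t = I0 at *
  generalize ∫ t in x..a + M * δ, t ^ 2 * p₁ t = I2 at *
  generalize ∫ t in x..a + M * δ, t ^ 6 * p₁ t = I6 at *
  generalize ∫ t in x..a + M * δ, t ^ 12 * p₁ t = I12 at *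
  generalize tailMoment 0 x = T at *
  have f0 : |s0 - I0| ≤ 4 * R0 * (ε * T) := by
    calc |s0 - I0| ≤ R0 * (δ * (1 + x ^ 3)) * T := e0
      _ ≤ R0 * (4 * ε) * T := by gcongr
      _ = _ := by ring
  have f0' : s0 ≤ (1 + 4 * R0) * T := by
    have : |s0 - I0| ≤ R0 * 4 * T := by
      calc |s0 - I0| ≤ R0 * (δ * (1 + x ^ 3)) * T := e0
        _ ≤ R0 * 4 * T := by gcongr
    linarith [le_abs_self (s0 - I0)]
  have f2 : |(s2 - I2) / d ^ 6| ≤ 4 * R2 * (ε * T) := by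
    rw [abs_div, abs_of_nonneg (by positivity : 0 ≤ d ^ 6)]
    calc |s2 - I2| / d ^ 6 ≤ R2 * (δ * (1 + x ^ 5)) * T / d ^ 6 := by gcongr
      _ = R2 * (δ * (1 + x ^ 5) / d ^ 6) * T := by ring
      _ ≤ R2 * (4 * ε) * T := by gcongr
      _ = _ := by ring
  have f6 : |(s6 - I6) / d ^ 6| ≤ 4 * R6 * (ε * T) := by
    rw [abs_div, abs_of_nonneg (by positivity : 0 ≤ d ^ 6)]
    calc |s6 - I6| / d ^ 6 ≤ R6 * (δ * (1 + x ^ 9)) * T / d ^ 6 := by gcongr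
      _ = R6 * (δ * (1 + x ^ 9) / d ^ 6) * T := by ring
      _ ≤ R6 * (4 * ε) * T := by gcongr
      _ = _ := by ring
  have f12 : (s0 + s12) / d ^ 12 ≤ (1 + 4 * R0 + (Q + 2 * R12)) * (ε * T) := by
    have g : s12 ≤ Q * (1 + x ^ 12) * T + R12 * (δ * (1 + x ^ 15)) * T := by
      have := (le_abs_self (s12 - I12)).trans e12
      norm_num at this
      linarith
    calc (s0 + s12) / d ^ 12
        ≤ ((1 + 4 * R0) * T + (Q * (1 + x ^ 12) * T + R12 * (δ * (1 + x ^ 15)) * T)) / d ^ 12 := by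
          gcongr
      _ = (1 + 4 * R0) * (1 / d ^ 12) * T + Q * ((1 + x ^ 12) / d ^ 12) * T
          + R12 * (δ * (1 + x ^ 15) / d ^ 12) * T := by ring
      _ ≤ (1 + 4 * R0) * ε * T + Q * ε * T + R12 * (2 * ε) * T := by gcongr
      _ = _ := by ring
  have f := hsum.trans (mul_le_mul_of_nonneg_left f12 hK₀)
  have g2 : 0 ≤ R2 * (ε * T) := by positivity
  have g6 : 0 ≤ R6 * (ε * T) := by positivity
  rw [sub_div] at f2 f6
  rw [sub_div, mul_div_assoc, mul_div_assoc] at f ⊢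
  generalize s2 / d ^ 6 = s2' at *
  generalize I2 / d ^ 6 = I2' at *
  generalize s6 / d ^ 6 = s6' at *
  generalize I6 / d ^ 6 = I6' at *
  rw [abs_le] at *
  constructor <;> linarith [f.1, f.2, f0.1, f0.2, f2.1, f2.2, f6.1, f6.2]

end TailSums

/-! ### Normalization and the quotient -/

section MainTheorem

open MeasureTheory Set Filter Topology

lemma integral_p₁ : ∫ t, p₁ t = 2 * tailMoment 0 0 := by
  have h := integral_comp_abs (f := p₁)
  rw [← tailMoment_zero] at h
  rw [← h]
  congr 1
  ext t
  simp [p₁, Even.pow_abs (by decide : Even 4)]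

lemma integral_p₂ : ∫ t, p₂ t = 2 * ∫ t in Ioi 0, p₂ t := by
  rw [← integral_comp_abs (f := p₂)]
  congr 1
  ext t
  simp [p₂, Even.pow_abs (by decide : Even 4), Even.pow_abs (by decide : Even 6)]

lemma one_sub_F (x : ℝ) : 1 - F x = tailMoment 0 x / ∫ t, p₁ t := by
  have h := intervalIntegral.integral_Iic_add_Ioi (b := x) integrable_p₁.integrableOn
    integrable_p₁.integrableOn
  have hpos : 0 < ∫ t, p₁ t := by
    rw [integral_p₁]; linarith [tailMoment_zero_pos 0]
  rw [F, tailMoment_zero, ← h] at *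
  field_simp
  ring

/-- For x ≤ n^{1/12} the growth x⁶ keeps the correction bounded after division by √n. -/
lemma exists_abs_setIntegral_p₂_le :
    ∃ L : ℝ, 0 < L ∧ ∀ x, 0 ≤ x → |(∫ t in Ioi x, p₂ t) / tailMoment 0 x| ≤ L * (1 + x ^ 6) := by
  obtain ⟨K2, hK2, h2⟩ := tailMoment_le 2
  obtain ⟨K6, hK6, h6⟩ := tailMoment_le 6
  refine ⟨2 * (K2 + K6), by positivity, fun x hx => ?_⟩
  have hT := tailMoment_zero_pos x
  rw [abs_div, abs_of_pos hT, div_le_iff₀ hT, setIntegral_p₂]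
  have m2 := tailMoment_nonneg hx 2
  have m6 := tailMoment_nonneg hx 6
  have a2 := h2 x hx
  have a6 := h6 x hx
  have hx2 : K2 * (1 + x ^ 2) * tailMoment 0 x ≤ K2 * (2 * (1 + x ^ 6)) * tailMoment 0 x := by
    gcongr
    have := pow_le_one_add_pow hx (by norm_num : 2 ≤ 6)
    linarith [pow_nonneg hx 6]
  have hx6 : 0 ≤ K6 * (1 + x ^ 6) * tailMoment 0 x := by positivity
  rw [abs_le]
  constructor <;> linarith

lemma abs_ratio_sub_le {u β e e' h q : ℝ} (hq : q = 1 + β * h + e') (hq2 : 1 / 2 ≤ q) :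
    |(1 + u * h + e) / q - 1 - (u - β) * h|
      ≤ 2 * (|e| + |e'| + |β| * |(u - β) * h ^ 2| + |e'| * |(u - β) * h|) := by
  have hq0 : 0 < q := by linarith
  have h1 : (1 + u * h + e) / q - 1 - (u - β) * h
      = (e - e' - β * ((u - β) * h ^ 2) - e' * ((u - β) * h)) / q := by
    rw [eq_div_iff hq0.ne', sub_mul, sub_mul, div_mul_cancel₀ _ hq0.ne', hq]
    ring
  have h2 : |e - e' - β * ((u - β) * h ^ 2) - e' * ((u - β) * h)|
      ≤ |e| + |e'| + |β| * |(u - β) * h ^ 2| + |e'| * |(u - β) * h| := by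
    rw [← abs_mul, ← abs_mul]
    refine (abs_sub _ _).trans ?_
    gcongr
    refine (abs_sub _ _).trans ?_
    gcongr
    exact abs_sub _ _
  rw [h1, abs_div, abs_of_pos hq0, div_le_iff₀ hq0]
  have h3 := (abs_nonneg _).trans h2
  nlinarith

lemma abs_quotient_sub_le {K L β d x u e e' : ℝ} (hK : 0 ≤ K) (hd : 1 ≤ d) (hx : 0 ≤ x)
    (hxd : x ≤ d) (hd6 : 2 * (|β| + K) ≤ d ^ 6) (hu : |u| ≤ L * (1 + x ^ 6))
    (he : |e| ≤ K * ((x ^ 12 + d ^ 4) / d ^ 12)) (he' : |e'| ≤ K / d ^ 8) :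
    |(1 + u / d ^ 6 + e) / (1 + β / d ^ 6 + e') - 1 - (u - β) / d ^ 6|
      ≤ 2 * (2 * K + 2 * |β| * (L + |β|) + 2 * (L + |β|) * K) * ((x ^ 12 + d ^ 4) / d ^ 12) := by
  have hd0 : 0 < d := by linarith
  obtain ⟨ε, hε⟩ : ∃ ε, ε = (x ^ 12 + d ^ 4) / d ^ 12 := ⟨_, rfl⟩
  rw [← hε] at he ⊢
  have hx6 : 0 ≤ x ^ 6 := by positivity
  have hd4 : 1 ≤ d ^ 4 := one_le_pow₀ hd
  have hd6' : 1 ≤ d ^ 6 := one_le_pow₀ hd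
  have hv : |u - β| ≤ (L + |β|) * (1 + x ^ 6) := by
    have := abs_sub u β
    nlinarith [mul_nonneg (abs_nonneg β) hx6]
  have hL : 0 ≤ L + |β| :=
    nonneg_of_mul_nonneg_left ((abs_nonneg _).trans hv) (by positivity)
  have hε8 : 1 / d ^ 8 ≤ ε := by
    rw [hε, div_le_div_iff₀ (by positivity) (by positivity)]
    nlinarith [mul_nonneg (by positivity : 0 ≤ x ^ 12) (by positivity : 0 ≤ d ^ 8)]
  have he8 : |e'| ≤ K * ε := by
    calc |e'| ≤ K * (1 / d ^ 8) := by rw [mul_one_div]; exact he'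
      _ ≤ K * ε := by gcongr
  have he6 : |e'| ≤ K / d ^ 6 := by
    refine he'.trans ?_
    gcongr
    norm_num
  have hq : 1 / 2 ≤ 1 + β * (1 / d ^ 6) + e' := by
    have h1 : |β| / d ^ 6 + K / d ^ 6 ≤ 1 / 2 := by
      rw [← add_div, div_le_iff₀ (by positivity)]
      linarith
    have h2 : -(|β| / d ^ 6) ≤ β * (1 / d ^ 6) := by
      rw [mul_one_div, ← neg_div]
      gcongr
      exact neg_abs_le β
    linarith [neg_abs_le e']
  have hA : |(u - β) * (1 / d ^ 6) ^ 2| ≤ 2 * (L + |β|) * ε := by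
    rw [abs_mul, abs_of_nonneg (by positivity : 0 ≤ (1 / d ^ 6) ^ 2)]
    calc |u - β| * (1 / d ^ 6) ^ 2 ≤ (L + |β|) * (1 + x ^ 6) * (1 / d ^ 6) ^ 2 := by gcongr
      _ = (L + |β|) * ((1 + x ^ 6) / d ^ 12) := by field_simp
      _ ≤ (L + |β|) * (2 * ε) := by
        gcongr
        rw [hε, ← mul_div_assoc]
        gcongr
        linarith [pow_le_one_add_pow hx (by norm_num : 6 ≤ 12), pow_nonneg hx 12]
      _ = _ := by ring
  have hB : |(u - β) * (1 / d ^ 6)| ≤ 2 * (L + |β|) := by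
    rw [abs_mul, abs_of_nonneg (by positivity : 0 ≤ 1 / d ^ 6)]
    calc |u - β| * (1 / d ^ 6) ≤ (L + |β|) * (1 + x ^ 6) * (1 / d ^ 6) := by gcongr
      _ = (L + |β|) * ((1 + x ^ 6) / d ^ 6) := by ring
      _ ≤ (L + |β|) * 2 := by
        gcongr
        rw [div_le_iff₀ (by positivity)]
        linarith [pow_le_pow_left₀ hx hxd 6]
      _ = _ := by ring
  have h := abs_ratio_sub_le (u := u) (e := e) rfl hq
  simp only [mul_one_div] at h hA hB
  refine h.trans ?_
  have h1 : |β| * |(u - β) * (1 / d ^ 6) ^ 2| ≤ |β| * (2 * (L + |β|) * ε) := by gcongr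
  have h2 : |e'| * |(u - β) / d ^ 6| ≤ K * ε * (2 * (L + |β|)) := by
    gcongr
    exact (abs_nonneg _).trans he8
  linarith

/-- The same c serves every x, in particular x = 0, so it cancels between numerator and
normalization. -/
lemma exists_tail_approx :
    ∃ K : ℝ, 0 < K ∧ ∀ n : ℕ, 64 ≤ n → ∀ d : ℝ, 1 ≤ d → d ^ 12 = n → ∃ c : ℝ, 0 < c ∧
      latticeWeight n ((n + 1) / 2) ≤ K * c ∧
      ∀ x, 0 ≤ x → x ≤ d →
        |2 / d ^ 9 * ((∑ k ∈ Finset.range (n + 1) with x * d ^ 9 < 2 * ((k : ℕ) : ℝ) - n,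
            latticeWeight n k) / c) - (tailMoment 0 x + (∫ t in Ioi x, p₂ t) / d ^ 6)|
          ≤ K * ((x ^ 12 + d ^ 4) / d ^ 12) * tailMoment 0 x := by
  obtain ⟨K₁, hK₁, h₁⟩ := exists_latticeWeight_approx
  obtain ⟨K₂, hK₂, h₂⟩ := exists_tail_sum_approx hK₁.le
  refine ⟨K₁ + K₂, by positivity, fun n hn d hd hdn => ?_⟩
  have hd0 : 0 < d := by linarith
  obtain ⟨c, hc, hc0, hck⟩ := h₁ n hn (d ^ 3) (by positivity) (by rw [← hdn]; ring)
  refine ⟨c, hc, hc0.trans (by gcongr; linarith), fun x hx hxd => ?_⟩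
  -- Floor plus one, not ceiling: the event is strict, so a lattice point exactly at x is excluded.
  obtain ⟨k₁, hk₁⟩ : ∃ k₁, k₁ = ⌊(x * d ^ 9 + n) / 2⌋₊ + 1 := ⟨_, rfl⟩
  have hy : 0 ≤ (x * d ^ 9 + n) / 2 := by positivity
  have hP : ∀ k : ℕ, x * d ^ 9 < 2 * (k : ℝ) - n ↔ k₁ ≤ k := by
    intro k
    rw [hk₁, Nat.succ_le_iff, Nat.floor_lt hy]
    constructor <;> intro h <;> linarith
  have hl : x * d ^ 9 < 2 * (k₁ : ℝ) - n := (hP k₁).2 le_rfl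
  have hu : 2 * (k₁ : ℝ) - n ≤ x * d ^ 9 + 2 := by
    have := Nat.floor_le hy
    rw [hk₁]
    push_cast
    linarith
  have hk₁n : (n + 1) / 2 ≤ k₁ := by
    have h0 : 0 ≤ x * d ^ 9 := by positivity
    have : (n : ℝ) < 2 * k₁ := by linarith
    have : n < 2 * k₁ := by exact_mod_cast this
    omega
  have hd9 : 0 < d ^ 9 := by positivity
  have key := h₂ d x ((2 * k₁ - n) / d ^ 9)
    ((∑ k ∈ Finset.range (n + 1) with x * d ^ 9 < 2 * ((k : ℕ) : ℝ) - n, latticeWeight n k) / c)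
    (fun i => latticeWeight n (k₁ + i) / c) hd hx hxd ?_ ?_ ?_ ?_
  · refine key.trans ?_
    have hT := (tailMoment_zero_pos x).le
    gcongr
    linarith
  · rw [le_div_iff₀ hd9]; exact hl.le
  · rw [div_le_iff₀ hd9, add_mul, div_mul_cancel₀ _ hd9.ne']
    exact hu
  · intro i t ht
    have h := hck (k₁ + i) (by omega) t (by rw [ht]; push_cast; field_simp; ring)
    rw [← pow_mul, ← pow_mul] at h
    have hscale : |latticeWeight n (k₁ + i) - c * (p₁ t + p₂ t / d ^ 6)|
        = c * |latticeWeight n (k₁ + i) / c - (p₁ t + p₂ t / d ^ 6)| := by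
      rw [← abs_of_pos hc, ← abs_mul, abs_of_pos hc, mul_sub, mul_div_cancel₀ _ hc.ne']
    norm_num at h
    rw [hscale] at h
    exact le_of_mul_le_mul_left h hc
  · filter_upwards [eventually_ge_atTop (n + 1)] with M hM
    rw [← Finset.sum_div, sum_filter_latticeWeight_eq n hP hM]

lemma rpow_div_twelve {n : ℕ} {d : ℝ} (hd : d = (n : ℝ) ^ (1 / 12 : ℝ)) (j : ℕ) (r : ℝ)
    (hr : r = j / 12) : (n : ℝ) ^ r = d ^ j := by
  rw [hd, ← Real.rpow_natCast, ← Real.rpow_mul n.cast_nonneg, hr]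
  congr 1
  ring

lemma exists_normalization_approx {K : ℝ} (hK : 0 < K) :
    ∃ K' : ℝ, K ≤ K' ∧ ∀ (n : ℕ) (c d : ℝ), 1 ≤ d → 0 < c →
      latticeWeight n ((n + 1) / 2) ≤ K * c →
      |2 / d ^ 9 * ((∑ k ∈ Finset.range (n + 1) with n < 2 * k, latticeWeight n k) / c)
          - (tailMoment 0 0 + (∫ t in Ioi 0, p₂ t) / d ^ 6)| ≤ K / d ^ 8 * tailMoment 0 0 →
      |2 / d ^ 9 * ((∑ k ∈ Finset.range (n + 1), latticeWeight n k) / c) / (∫ t, p₁ t)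
          - 1 - (∫ t, p₂ t) / (∫ t, p₁ t) / d ^ 6| ≤ K' / d ^ 8 := by
  have hT := tailMoment_zero_pos 0
  -- The summand K comes from the tail at 0; K / `tailMoment 0 0` comes from the middle weight,
  -- divided by the total mass of p₁.
  refine ⟨K * (1 + 1 / tailMoment 0 0), ?_, fun n c d hd hc hmid h => ?_⟩
  · exact le_mul_of_one_le_right hK.le (by linarith [one_div_pos.2 hT])
  have hd0 : 0 < d := by linarith
  obtain ⟨m, hm⟩ : ∃ m, m = ∑ k ∈ Finset.range (n + 1) with n = 2 * k, latticeWeight n k :=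
    ⟨_, rfl⟩
  have hm0 : 0 ≤ m := hm ▸ Finset.sum_nonneg fun k _ => latticeWeight_nonneg n k
  have hmc : m / c ≤ K := by
    rw [div_le_iff₀ hc, hm]
    exact (sum_latticeWeight_middle n).trans hmid
  have hmc0 : 0 ≤ m / c := by positivity
  have hmd : 2 / d ^ 9 * (m / c) ≤ 2 * K / d ^ 8 := by
    calc 2 / d ^ 9 * (m / c) ≤ 2 / d ^ 8 * K := by
          gcongr
          norm_num
      _ = _ := by ring
  have hmd0 : 0 ≤ 2 / d ^ 9 * (m / c) := by positivity
  rw [sum_latticeWeight, ← hm, integral_p₁, integral_p₂]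
  generalize ∑ k ∈ Finset.range (n + 1) with n < 2 * k, latticeWeight n k = N at *
  generalize tailMoment 0 0 = T at *
  generalize ∫ t in Ioi 0, p₂ t = B at *
  have e : 2 / d ^ 9 * ((2 * N + m) / c) / (2 * T) - 1 - 2 * B / (2 * T) / d ^ 6
      = (2 * (2 / d ^ 9 * (N / c) - (T + B / d ^ 6)) + 2 / d ^ 9 * (m / c)) / (2 * T) := by
    field_simp
    ring
  rw [e, abs_div, abs_of_pos (by positivity : 0 < 2 * T), div_le_iff₀ (by positivity)]
  have e2 : K * (1 + 1 / T) / d ^ 8 * (2 * T) = 2 * (K / d ^ 8 * T) + 2 * K / d ^ 8 := by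
    field_simp
  rw [e2]
  rw [abs_le] at *
  constructor <;> linarith [h.1, h.2]

theorem exists_abs_prob_div_sub_le :
    ∃ C : ℝ, 0 < C ∧ ∃ N : ℕ, ∀ n : ℕ, N ≤ n →
      ∀ x : ℝ, 0 ≤ x → x ≤ (n : ℝ) ^ (1 / 12 : ℝ) →
        |prob 1 0 {σ : Config n | x < W σ} / (1 - F x) - 1 - G x / Real.sqrt (n : ℝ)|
          ≤ C * (x ^ 12 + (n : ℝ) ^ (1 / 3 : ℝ)) / (n : ℝ) := by
  obtain ⟨K, hK, happrox⟩ := exists_tail_approx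
  obtain ⟨K', hKK', hnorm⟩ := exists_normalization_approx hK
  obtain ⟨L, hL, hu⟩ := exists_abs_setIntegral_p₂_le
  have hK' : 0 < K' := hK.trans_le hKK'
  have hApos : 0 < ∫ t, p₁ t := by rw [integral_p₁]; linarith [tailMoment_zero_pos 0]
  obtain ⟨β, hβ⟩ : ∃ β, β = (∫ t, p₂ t) / ∫ t, p₁ t := ⟨_, rfl⟩
  -- The threshold 64 serves the local expansion; the other gives √n ≥ 2(|β| + K'), which keeps the
  -- normalized denominator at least 1/2.
  refine ⟨2 * (2 * K' + 2 * |β| * (L + |β|) + 2 * (L + |β|) * K'), by positivity,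
    max 64 ⌈(2 * (|β| + K')) ^ 2⌉₊, fun n hn x hx hxn => ?_⟩
  have hn64 : 64 ≤ n := (le_max_left _ _).trans hn
  have hn1 : (1 : ℝ) ≤ n := by exact_mod_cast (by omega : 1 ≤ n)
  have hnβ : (2 * (|β| + K')) ^ 2 ≤ n := Nat.ceil_le.1 ((le_max_right _ _).trans hn)
  obtain ⟨d, hd⟩ : ∃ d, d = (n : ℝ) ^ (1 / 12 : ℝ) := ⟨_, rfl⟩
  have hd1 : 1 ≤ d := hd ▸ Real.one_le_rpow hn1 (by norm_num)
  have hd0 : 0 < d := by linarith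
  have hd12 : d ^ 12 = n := by
    rw [← rpow_div_twelve hd 12 1 (by norm_num), Real.rpow_one]
  have hsqrt : Real.sqrt (n : ℝ) = d ^ 6 := by
    rw [Real.sqrt_eq_rpow, rpow_div_twelve hd 6 (1 / 2) (by norm_num)]
  rw [← hd] at hxn
  have hd6 : 2 * (|β| + K') ≤ d ^ 6 := by
    rw [← hsqrt]
    exact Real.le_sqrt_of_sq_le hnβ
  obtain ⟨c, hc, hmid, htail⟩ := happrox n hn64 d hd1 hd12
  have hT := tailMoment_zero_pos x
  have hx0 := htail x hx hxn
  have h00 := htail 0 le_rfl hd0.le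
  have e8 : (0 ^ 12 + d ^ 4) / d ^ 12 = 1 / d ^ 8 := by field_simp; ring
  simp only [zero_mul, sub_pos] at h00
  rw [e8, mul_one_div] at h00
  have hcast : ∀ k : ℕ, ((n : ℝ) < 2 * (k : ℝ)) ↔ n < 2 * k := by
    intro k; exact_mod_cast Iff.rfl
  simp only [hcast] at h00
  have hD := hnorm n c d hd1 hc hmid h00
  rw [prob_eq (by omega), rpow_div_twelve hd 9 (3 / 4) (by norm_num),
    rpow_div_twelve hd 4 (1 / 3) (by norm_num), hsqrt, one_sub_F, G, ← tailMoment_zero, ← hβ,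
    mul_div_assoc]
  rw [← hβ] at hD
  have hDpos : 0 < ∑ k ∈ Finset.range (n + 1), latticeWeight n k :=
    Finset.sum_pos (fun k hk => latticeWeight_pos (by simpa [Nat.lt_succ_iff] using hk)) (by simp)
  have hux := hu x hx
  generalize ∑ k ∈ Finset.range (n + 1) with x * d ^ 9 < 2 * ((k : ℕ) : ℝ) - n,
    latticeWeight n k = N at *
  generalize ∑ k ∈ Finset.range (n + 1), latticeWeight n k = D at *
  generalize ∫ t, p₁ t = A at *
  generalize tailMoment 0 x = T at *
  obtain ⟨u, hu'⟩ : ∃ u, u = (∫ t in Ioi x, p₂ t) / T := ⟨_, rfl⟩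
  have hp₂ : ∫ t in Ioi x, p₂ t = u * T := by rw [hu']; field_simp
  rw [← hu'] at hux ⊢
  rw [hp₂] at hx0
  have he : |2 / d ^ 9 * (N / c) / T - 1 - u / d ^ 6| ≤ K' * ((x ^ 12 + d ^ 4) / d ^ 12) := by
    have e1 : 2 / d ^ 9 * (N / c) / T - 1 - u / d ^ 6
        = (2 / d ^ 9 * (N / c) - (T + u * T / d ^ 6)) / T := by
      field_simp
      ring
    rw [e1, abs_div, abs_of_pos hT, div_le_iff₀ hT]
    exact hx0.trans (by gcongr)
  have key := abs_quotient_sub_le hK'.le hd1 hx hxn hd6 hux he hD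
  -- Scaling N and D by the same 2/(d⁹c) exposes both expansions without changing the quotient.
  have e2 : N / D / (T / A) = (1 + u / d ^ 6 + (2 / d ^ 9 * (N / c) / T - 1 - u / d ^ 6))
      / (1 + β / d ^ 6 + (2 / d ^ 9 * (D / c) / A - 1 - β / d ^ 6)) := by
    rw [show 1 + u / d ^ 6 + (2 / d ^ 9 * (N / c) / T - 1 - u / d ^ 6)
      = 2 / d ^ 9 * (N / c) / T by ring, show 1 + β / d ^ 6 +
      (2 / d ^ 9 * (D / c) / A - 1 - β / d ^ 6) = 2 / d ^ 9 * (D / c) / A by ring]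
    field_simp
  rw [e2, ← hd12]
  exact key

end MainTheorem

end CurieWeiss

end

theorem theorem1p4 :
    ∃ C : ℝ, 0 < C ∧ ∃ N : ℕ, ∀ n : ℕ, N ≤ n →
      ∀ x : ℝ, 0 ≤ x → x ≤ (n : ℝ) ^ (1 / 12 : ℝ) →
        |CurieWeiss.prob 1 0 {σ : CurieWeiss.Config n | x < CurieWeiss.W σ}
              / (1 - CurieWeiss.F x)
            - 1 - CurieWeiss.G x / Real.sqrt (n : ℝ)|
          ≤ C * (x ^ 12 + (n : ℝ) ^ (1 / 3 : ℝ)) / (n : ℝ) :=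
  CurieWeiss.exists_abs_prob_div_sub_le
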